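/- Let $T>0$, let $U\subset\mathbb R^m$ be connected and compact, $\xi\in\mathbb R^n$, and let $f\colon[0,T]\times\mathbb R^n\times\mathbb R^m\to\mathbb R^n$ and $\Psi\colon\mathbb R^n\to\mathbb R$ be Lipschitz continuously differentiable in the following sense: $\Psi$ is differentiable, $f$ is differentiable in $x$ and in $u$ at every point of $[0,T]\times\mathbb R^n\times U$, and there is $L>0$ such that $\Psi$ and $\frac{\partial\Psi}{\partial x}$ are $L$-Lipschitz on $\mathbb R^n$, and $g=f,\frac{\partial f}{\partial x},\frac{\partial f}{\partial u}$ satisfy $\|g(t_1,x_1,u_1)-g(t_2,x_2,u_2)\|\le L(|t_1-t_2|+\|x_1-x_2\|_2+\|u_1-u_2\|_2)$ on $[0,T]\times\mathbb R^n\times U$ (Euclidean norm, respectively induced operator norm). Consider the optimal control problem $$\min\ \Psi(x(T))\quad\text{subject to}\quad x(0)=\xi,\ \ \dot x(t)=f(t,x(t),u(t)),\ \ u(t)\in U\ \text{for a.e. } t\in[0,T],\tag{1}$$ over $x\in L^2([0,T],\mathbb R^n)$ and $u\in L^2([0,T],\mathbb R^m)$; differential equations are understood in the sense of Carathéodory (absolutely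 continuous solutions, equation for a.e. $t$). Let $\mathcal X$ be its set of feasible pairs $(x,u)$. A function $\theta\colon\mathcal X\to(-\infty,0]$ is an *optimality function* of (1) if $\theta(\hat x,\hat u)=0$ for every minimizer $(\hat x,\hat u)$ of (1). For $(x,u_0)\in\mathcal X$ let $$\theta_{o,l}(x,u_0)=\min_{\delta x\in L^2,\ \delta u\in L^2}\ \tfrac{\partial\Psi}{\partial x}(x(T))^{\mathsf T}\delta x(T)$$ subject to $\delta x(0)=0$, $\ \dot{\delta x}(t)=\frac{\partial f}{\partial x}(t,x(t),u_0(t))\,\delta x(t)+\frac{\partial f}{\partial u}(t,x(t),u_0(t))\,\delta u(t)$, and $u_0(t)+\delta u(t)\in U$ for a.e. $t\in[0,T]$. Let $$\theta_{o,h}(x,u_0)=\min_{u\in L^2,\ u(t)\in U\text{ a.e.}}\ \int_0^T H_0(t,x(t),u(t),p_0(t))-H_0(t,x(t),u_0(t),p_0(t))\,dt,$$ where $H_0(t,x,u,p)=p^{\mathsf T}f(t,x,u)$ is the Hamiltonian and the costate $p_0$ is the solution of $p_0(T)=\frac{\partial\Psi}{\partial x}(x(T))$, $\ \dot p_0(t)=-\frac{\partial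 f}{\partial x}(t,x(t),u_0(t))^{\mathsf T}p_0(t)$ on $[0,T]$. Then, for every $(x,u_0)\in\mathcal X$, the costate exists and is unique on $[0,T]$, both minima are attained (so $\theta_{o,l}$ and $\theta_{o,h}$ are well-defined real-valued functions on $\mathcal X$), and $\theta_{o,l}\le 0$. Moreover: 1. if $U$ is convex, then $\theta_{o,l}$ is an optimality function of (1); 2. $\theta_{o,h}$ is an optimality function of (1) (convexity of $U$ is not needed). -/

import Mathlib

open MeasureTheory Set

/-- The data of an optimal control problem with state space `ℝⁿ` and input space `ℝᵐ`
(both with the Euclidean norm): minimize `Ψ (x T)` subject to `x 0 = ξ`,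
`x' t = f t (x t) (u t)` and `u t ∈ U` for almost every `t ∈ [0, T]`. -/
structure ControlProblem (n m : ℕ) where
  /-- The time horizon. -/
  T : ℝ
  /-- The set of admissible input values. -/
  U : Set (EuclideanSpace ℝ (Fin m))
  /-- The initial state. -/
  ξ : EuclideanSpace ℝ (Fin n)
  /-- The vector field. -/
  f : ℝ → EuclideanSpace ℝ (Fin n) → EuclideanSpace ℝ (Fin m) → EuclideanSpace ℝ (Fin n)
  /-- The final cost. -/
  Ψ : EuclideanSpace ℝ (Fin n) → ℝ

/-- Given an optimization problem "minimize `J` over `X`", a real function `θ` is an optimality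
function if it is nonpositive on `X` and vanishes at every minimizer. -/
def IsOptimalityFunction {α : Type*} (X : Set α) (J θ : α → ℝ) : Prop :=
  (∀ z ∈ X, θ z ≤ 0) ∧ ∀ z ∈ X, IsMinOn J X z → θ z = 0

namespace ControlProblem

variable {n m : ℕ} (P : ControlProblem n m)

/-- Lebesgue measure on `[0, T]`. -/
noncomputable def timeMeasure : Measure ℝ := volume.restrict (Icc 0 P.T)

/-- The partial derivative `∂f/∂x (t, x, u)`. -/
noncomputable def fx (t : ℝ) (x : EuclideanSpace ℝ (Fin n)) (u : EuclideanSpace ℝ (Fin m)) :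
    EuclideanSpace ℝ (Fin n) →L[ℝ] EuclideanSpace ℝ (Fin n) :=
  fderiv ℝ (fun y => P.f t y u) x

/-- The partial derivative `∂f/∂u (t, x, u)`. -/
noncomputable def fu (t : ℝ) (x : EuclideanSpace ℝ (Fin n)) (u : EuclideanSpace ℝ (Fin m)) :
    EuclideanSpace ℝ (Fin m) →L[ℝ] EuclideanSpace ℝ (Fin n) :=
  fderiv ℝ (fun v => P.f t x v) u

/-- `f` and `Ψ` are Lipschitz continuously differentiable with constant `L`: `Ψ` is differentiable,
`f` is differentiable in `x` and in `u` at all points of `[0, T] × ℝⁿ × U`, and `Ψ`, `∂Ψ/∂x`, `f`,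
`∂f/∂x`, `∂f/∂u` are Lipschitz there. -/
structure LipschitzC1With (L : ℝ) : Prop where
  diff_Ψ : ∀ x, DifferentiableAt ℝ P.Ψ x
  diff_x : ∀ t ∈ Icc 0 P.T, ∀ x, ∀ u ∈ P.U, DifferentiableAt ℝ (fun y => P.f t y u) x
  diff_u : ∀ t ∈ Icc 0 P.T, ∀ x, ∀ u ∈ P.U, DifferentiableAt ℝ (fun v => P.f t x v) u
  lip_Ψ : ∀ x₁ x₂, |P.Ψ x₁ - P.Ψ x₂| ≤ L * ‖x₁ - x₂‖
  lip_grad : ∀ x₁ x₂, ‖gradient P.Ψ x₁ - gradient P.Ψ x₂‖ ≤ L * ‖x₁ - x₂‖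
  lip_f : ∀ t₁ ∈ Icc 0 P.T, ∀ t₂ ∈ Icc 0 P.T, ∀ x₁ x₂, ∀ u₁ ∈ P.U, ∀ u₂ ∈ P.U,
    ‖P.f t₁ x₁ u₁ - P.f t₂ x₂ u₂‖ ≤ L * (|t₁ - t₂| + ‖x₁ - x₂‖ + ‖u₁ - u₂‖)
  lip_fx : ∀ t₁ ∈ Icc 0 P.T, ∀ t₂ ∈ Icc 0 P.T, ∀ x₁ x₂, ∀ u₁ ∈ P.U, ∀ u₂ ∈ P.U,
    ‖P.fx t₁ x₁ u₁ - P.fx t₂ x₂ u₂‖ ≤ L * (|t₁ - t₂| + ‖x₁ - x₂‖ + ‖u₁ - u₂‖)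
  lip_fu : ∀ t₁ ∈ Icc 0 P.T, ∀ t₂ ∈ Icc 0 P.T, ∀ x₁ x₂, ∀ u₁ ∈ P.U, ∀ u₂ ∈ P.U,
    ‖P.fu t₁ x₁ u₁ - P.fu t₂ x₂ u₂‖ ≤ L * (|t₁ - t₂| + ‖x₁ - x₂‖ + ‖u₁ - u₂‖)

/-- `y` is a (Carathéodory) solution on `[0, T]` of `y' = g`, `y 0 = a`: it is the absolutely
continuous function with initial value `a` and with derivative `g t` at almost every `t`. -/
def SolvesFrom (y g : ℝ → EuclideanSpace ℝ (Fin n)) (a : EuclideanSpace ℝ (Fin n)) : Prop :=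
  Integrable g P.timeMeasure ∧ ∀ t ∈ Icc 0 P.T, y t = a + ∫ s in (0 : ℝ)..t, g s

/-- `u` is an admissible input: square integrable on `[0, T]` with values in `U` almost
everywhere. -/
def IsInput (u : ℝ → EuclideanSpace ℝ (Fin m)) : Prop :=
  MemLp u 2 P.timeMeasure ∧ ∀ᵐ t ∂P.timeMeasure, u t ∈ P.U

/-- The feasible set of the problem: the pairs `(x, u)` of an admissible input and its
trajectory. -/
def feasible : Set ((ℝ → EuclideanSpace ℝ (Fin n)) × (ℝ → EuclideanSpace ℝ (Fin m))) :=
  {z | MemLp z.1 2 P.timeMeasure ∧ P.IsInput z.2 ∧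
    P.SolvesFrom z.1 (fun t => P.f t (z.1 t) (z.2 t)) P.ξ}

/-- The objective of the problem, `Ψ (x T)`. -/
def cost (z : (ℝ → EuclideanSpace ℝ (Fin n)) × (ℝ → EuclideanSpace ℝ (Fin m))) : ℝ :=
  P.Ψ (z.1 P.T)

/-- The values of the objective of the linearized problem at the pair `z = (x, u₀)`, over all its
feasible variations `(δx, δu)`. -/
def linValues (z : (ℝ → EuclideanSpace ℝ (Fin n)) × (ℝ → EuclideanSpace ℝ (Fin m))) : Set ℝ :=
  {v | ∃ (δx : ℝ → EuclideanSpace ℝ (Fin n)) (δu : ℝ → EuclideanSpace ℝ (Fin m)),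
    MemLp δx 2 P.timeMeasure ∧ MemLp δu 2 P.timeMeasure ∧
    P.SolvesFrom δx
      (fun t => P.fx t (z.1 t) (z.2 t) (δx t) + P.fu t (z.1 t) (z.2 t) (δu t)) 0 ∧
    (∀ᵐ t ∂P.timeMeasure, z.2 t + δu t ∈ P.U) ∧
    v = inner ℝ (gradient P.Ψ (z.1 P.T)) (δx P.T)}

/-- The function `θ_{o,l}`: the minimal value of the linearized problem. -/
noncomputable def thetaL
    (z : (ℝ → EuclideanSpace ℝ (Fin n)) × (ℝ → EuclideanSpace ℝ (Fin m))) : ℝ :=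
  sInf (P.linValues z)

/-- `p` solves the costate equation of the pair `z = (x, u₀)` on `[0, T]`, in the sense of
Carathéodory: `p T = ∂Ψ/∂x (x T)` and `p' t = - ∂f/∂x (t, x t, u₀ t)ᵀ p t` for a.e. `t`. -/
def IsCostate (z : (ℝ → EuclideanSpace ℝ (Fin n)) × (ℝ → EuclideanSpace ℝ (Fin m)))
    (p : ℝ → EuclideanSpace ℝ (Fin n)) : Prop :=
  Integrable (fun t => (P.fx t (z.1 t) (z.2 t)).adjoint (p t)) P.timeMeasure ∧
  ∀ t ∈ Icc 0 P.T, p t = gradient P.Ψ (z.1 P.T) +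
    ∫ s in t..P.T, (P.fx s (z.1 s) (z.2 s)).adjoint (p s)

/-- The costate of the pair `z = (x, u₀)`. -/
noncomputable def costate
    (z : (ℝ → EuclideanSpace ℝ (Fin n)) × (ℝ → EuclideanSpace ℝ (Fin m))) :
    ℝ → EuclideanSpace ℝ (Fin n) :=
  Classical.epsilon (P.IsCostate z)

/-- The Hamiltonian `H₀ (t, x, u, p) = pᵀ f (t, x, u)`. -/
noncomputable def hamiltonian (t : ℝ) (x : EuclideanSpace ℝ (Fin n))
    (u : EuclideanSpace ℝ (Fin m)) (p : EuclideanSpace ℝ (Fin n)) : ℝ :=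
  inner ℝ p (P.f t x u)

/-- The values of the integrated Hamiltonian difference at the pair `z = (x, u₀)`, over all
admissible inputs `u`. -/
def hamValues (z : (ℝ → EuclideanSpace ℝ (Fin n)) × (ℝ → EuclideanSpace ℝ (Fin m))) : Set ℝ :=
  {v | ∃ u : ℝ → EuclideanSpace ℝ (Fin m), P.IsInput u ∧
    v = ∫ t in (0 : ℝ)..P.T, (P.hamiltonian t (z.1 t) (u t) (P.costate z t) -
      P.hamiltonian t (z.1 t) (z.2 t) (P.costate z t))}

/-- The function `θ_{o,h}`: the minimal value of the integrated Hamiltonian difference. -/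
noncomputable def thetaH
    (z : (ℝ → EuclideanSpace ℝ (Fin n)) × (ℝ → EuclideanSpace ℝ (Fin m))) : ℝ :=
  sInf (P.hamValues z)

end ControlProblem

/-! Everything rests on the costate `p`. Integration by parts (`integral_inner_primitive`,
`IsCostate.inner_gradient_eq`) turns ∂Ψ/∂x(x(T))ᵀ d(T), for any absolutely continuous `d` with `d 0
= 0`, into ∫ pᵀ(d' - f_x d). For a linearized variation this is ∫ pᵀ f_u δu, so the objectives of
both auxiliary problems are integrals of a function of the time and the control value alone. They
can be minimized separately at each time over the compact set `U`, and a measurable selection of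
minimizers (`exists_measurable_argmin`) is an admissible input that attains the minimum. The
unchanged input has value zero, so both minima are nonpositive.

It remains to see that at a minimizer of the control problem every competing value `v` is
nonnegative. Applied to the difference of two trajectories, which Gronwall bounds by K I with I = ∫
‖w - u₀‖, the same identity gives the increment formula `LipschitzC1With.exists_cost_sub_le`: the
cost changes by at most the integrated change of the Hamiltonian plus C I². That the remainder is
quadratic in the L¹ norm is decisive: changing the input on a set of measure T/N costs O(1/N²),
whereas its squared L² norm is only O(1/N).

Two families of inputs with I = O(1/N) are then tested. For convex `U`, u₀ + δu/N changes the
Hamiltonian integral by at most v/N + O(1/N²). For arbitrary `U`, a competitor `u` replaces u₀ on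
one interval of length T/N, chosen by pigeonhole so that the Hamiltonian gains at most v/N there.
Either way optimality gives 0 ≤ v/N + C'/N² for all N, hence v ≥ 0. -/

section Selection

/-! ### Measurable selection of minimizers -/

variable {α E : Type*} [MeasurableSpace α]

/-- A weakly measurable multifunction with nonempty compact values. -/
structure MeasurableCompactValued [TopologicalSpace E] (A : α → Set E) : Prop where
  isCompact : ∀ a, IsCompact (A a)
  nonempty : ∀ a, (A a).Nonempty
  measurableSet : ∀ K, IsClosed K → MeasurableSet {a | (A a ∩ K).Nonempty}

/-- Some minimizer lies in `K` exactly when `A a` meets `K` and, for each rational `q`, a point of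
`A a` with `l ≤ q` can be replaced by one in `K`. This is a countable combination of hitting events
for closed sets. -/
theorem MeasurableCompactValued.argmin [TopologicalSpace E] [T2Space E] {A : α → Set E}
    (hA : MeasurableCompactValued A) {l : E → ℝ} (hl : Continuous l) :
    MeasurableCompactValued fun a => {v ∈ A a | ∀ w ∈ A a, l v ≤ l w} where
  isCompact a := by
    refine (hA.isCompact a).of_isClosed_subset ?_ fun v hv => hv.1
    refine (hA.isCompact a).isClosed.inter ?_
    have : {v | ∀ w ∈ A a, l v ≤ l w} = ⋂ w ∈ A a, {v | l v ≤ l w} := by ext; simp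
    change IsClosed {v | ∀ w ∈ A a, l v ≤ l w}
    rw [this]
    exact isClosed_biInter fun w _ => isClosed_le hl continuous_const
  nonempty a := by
    obtain ⟨v, hv, h⟩ := (hA.isCompact a).exists_isMinOn (hA.nonempty a) hl.continuousOn
    exact ⟨v, hv, fun w hw => h hw⟩
  measurableSet K hK := by
    have key : {a | ({v ∈ A a | ∀ w ∈ A a, l v ≤ l w} ∩ K).Nonempty} =
        {a | (A a ∩ K).Nonempty} ∩ ⋂ q : ℚ, ({a | (A a ∩ {v | l v ≤ q}).Nonempty}ᶜ ∪
          {a | (A a ∩ (K ∩ {v | l v ≤ q})).Nonempty}) := by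
      ext a
      simp only [mem_ofPred_eq, mem_inter_iff, mem_iInter, mem_union, mem_compl_iff]
      constructor
      · rintro ⟨v, ⟨hv, hmin⟩, hvK⟩
        refine ⟨⟨v, hv, hvK⟩, fun q => ?_⟩
        by_cases hq : (A a ∩ {v | l v ≤ q}).Nonempty
        · obtain ⟨w, hw, hwq⟩ := hq
          exact Or.inr ⟨v, hv, hvK, (hmin w hw).trans hwq⟩
        · exact Or.inl hq
      · rintro ⟨hne, h⟩
        obtain ⟨v, hv, hmin⟩ := ((hA.isCompact a).inter_right hK).exists_isMinOn hne
          hl.continuousOn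
        refine ⟨v, ⟨hv.1, fun w hw => ?_⟩, hv.2⟩
        refine le_of_forall_gt_imp_ge_of_dense fun c hc => ?_
        obtain ⟨q, hq1, hq2⟩ := exists_rat_btwn hc
        rcases h q with h | ⟨x, hx, hxK, hxq⟩
        · exact absurd ⟨w, hw, hq1.le⟩ h
        · exact ((hmin ⟨hx, hxK⟩ : l v ≤ l x).trans hxq).trans hq2.le
    rw [key]
    have hcl : ∀ q : ℚ, IsClosed {v | l v ≤ q} := fun q => isClosed_le hl continuous_const
    exact (hA.measurableSet K hK).inter (MeasurableSet.iInter fun q =>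
      (hA.measurableSet _ (hcl q)).compl.union (hA.measurableSet _ (hK.inter (hcl q))))

/-- Lexicographic minimization: each function in turn is minimized over the set left by the others,
and is constant on its own argmin. -/
theorem MeasurableCompactValued.exists_subset_const [TopologicalSpace E] [T2Space E]
    {A : α → Set E} (hA : MeasurableCompactValued A) (ls : List (E → ℝ))
    (hls : ∀ l ∈ ls, Continuous l) :
    ∃ B : α → Set E, MeasurableCompactValued B ∧ (∀ a, B a ⊆ A a) ∧
      ∀ l ∈ ls, ∀ a, ∀ v ∈ B a, ∀ w ∈ B a, l v = l w := by
  induction ls with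
  | nil => exact ⟨A, hA, fun a => subset_rfl, by simp⟩
  | cons l ls ih =>
    obtain ⟨B, hB, hBA, hconst⟩ := ih fun l hl => hls l (List.mem_cons_of_mem _ hl)
    refine ⟨_, hB.argmin (hls l List.mem_cons_self), fun a v hv => hBA a hv.1, ?_⟩
    intro l' hl' a v hv w hw
    rcases List.mem_cons.1 hl' with rfl | hl'
    · exact le_antisymm (hv.2 w hw.1) (hw.2 v hv.1)
    · exact hconst l' hl' a v hv.1 w hw.1

/-- A weakly measurable compact-valued map into a Euclidean space has a measurable selection. -/
theorem MeasurableCompactValued.exists_measurable_selection {d : ℕ}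
    {A : α → Set (EuclideanSpace ℝ (Fin d))} (hA : MeasurableCompactValued A) :
    ∃ s : α → EuclideanSpace ℝ (Fin d), Measurable s ∧ ∀ a, s a ∈ A a := by
  -- Minimizing all coordinates lexicographically leaves a single point. The preimage of a closed
  -- set under this selection is then a hitting event, hence measurable.
  obtain ⟨B, hB, hBA, hconst⟩ := hA.exists_subset_const
    ((List.finRange d).map fun i v => v i) (by
      intro l hl
      obtain ⟨i, -, rfl⟩ := List.mem_map.1 hl
      fun_prop)
  have huniq : ∀ a, ∀ v ∈ B a, ∀ w ∈ B a, v = w := by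
    intro a v hv w hw
    ext i
    exact hconst _ (List.mem_map.2 ⟨i, List.mem_finRange i, rfl⟩) a v hv w hw
  choose s hs using hB.nonempty
  refine ⟨s, measurable_of_isClosed fun K hK => ?_, fun a => hBA a (hs a)⟩
  convert hB.measurableSet K hK using 1
  ext a
  refine ⟨fun h => ⟨s a, hs a, h⟩, ?_⟩
  rintro ⟨v, hv, hvK⟩
  rw [mem_preimage, huniq a (s a) (hs a) v hv]
  exact hvK

theorem measurableCompactValued_argmin [TopologicalSpace E] [TopologicalSpace.MetrizableSpace E]
    {U : Set E} (hU : IsCompact U) (hne : U.Nonempty) {φ : α → E → ℝ}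
    (hm : ∀ v ∈ U, Measurable fun a => φ a v) (hc : ∀ a, ContinuousOn (φ a) U) :
    MeasurableCompactValued fun a => {v ∈ U | ∀ w ∈ U, φ a v ≤ φ a w} where
  isCompact a := by
    have : {v ∈ U | ∀ w ∈ U, φ a v ≤ φ a w} = ⋂ w : U, U ∩ φ a ⁻¹' Iic (φ a w) := by
      ext v
      simp only [mem_ofPred_eq, mem_iInter, mem_inter_iff, mem_preimage, mem_Iic, Subtype.forall]
      exact ⟨fun h w hw => ⟨h.1, h.2 w hw⟩, fun h => ⟨(h _ hne.some_mem).1, fun w hw => (h w hw).2⟩⟩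
    rw [this]
    refine hU.of_isClosed_subset (isClosed_iInter fun w => ?_) ?_
    · exact (hc a).preimage_isClosed_of_isClosed hU.isClosed isClosed_Iic
    · exact (iInter_subset _ ⟨_, hne.some_mem⟩).trans inter_subset_left
  nonempty a := by
    obtain ⟨v, hv, h⟩ := hU.exists_isMinOn hne (hc a)
    exact ⟨v, hv, fun w hw => h hw⟩
  measurableSet K hK := by
    let _ := TopologicalSpace.metrizableSpaceMetric E
    obtain ⟨D, hDU, hD, hDd⟩ := (hU.inter_right hK).isSeparable.exists_countable_dense_subset
    obtain ⟨D', hDU', hD', hDd'⟩ := hU.isSeparable.exists_countable_dense_subset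
    -- A minimizer lies in `K` exactly when, for each `n`, a point of a countable dense subset of `U
    -- ∩ K` is minimal up to `1 / (n + 1)` against a countable dense subset of `U`. Compactness of
    -- `U ∩ K` gives the converse.
    have key : {a | ({v ∈ U | ∀ w ∈ U, φ a v ≤ φ a w} ∩ K).Nonempty} =
        ⋂ n : ℕ, ⋃ v ∈ D, ⋂ w ∈ D', {a | φ a v ≤ φ a w + 1 / ((n : ℝ) + 1)} := by
      ext a
      simp only [mem_ofPred_eq, mem_iInter, mem_iUnion, exists_prop]
      constructor
      · rintro ⟨v, ⟨hv, hmin⟩, hvK⟩ n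
        have h1 : ∀ᶠ x in nhdsWithin v U, φ a x < φ a v + 1 / ((n : ℝ) + 1) :=
          (hc a v hv).eventually_lt_const (by
            have : 0 < 1 / ((n : ℝ) + 1) := by positivity
            linarith)
        obtain ⟨O, hO, hvO, hOU⟩ := mem_nhdsWithin.1 h1
        obtain ⟨x, hxO, hxD⟩ := mem_closure_iff.1 (hDd ⟨hv, hvK⟩) O hO hvO
        refine ⟨x, hxD, fun w hw => ?_⟩
        have h2 : φ a x < φ a v + 1 / ((n : ℝ) + 1) := hOU ⟨hxO, (hDU hxD).1⟩
        linarith [hmin w (hDU' hw)]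
      · intro h
        have hne' : (U ∩ K).Nonempty := by
          obtain ⟨v, hv, -⟩ := h 0
          exact ⟨v, hDU hv⟩
        obtain ⟨v, hv, hmin⟩ := (hU.inter_right hK).exists_isMinOn hne'
          ((hc a).mono inter_subset_left)
        have h1 : ∀ w ∈ D', φ a v ≤ φ a w := by
          intro w hw
          refine le_of_forall_pos_le_add fun ε hε => ?_
          obtain ⟨n, hn⟩ := exists_nat_one_div_lt hε
          obtain ⟨x, hx, hxw⟩ := h n
          have h2 : φ a v ≤ φ a x := hmin (hDU hx)
          linarith [hxw w hw]
        refine ⟨v, ⟨hv.1, fun w hw => ?_⟩, hv.2⟩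
        by_contra! hlt
        obtain ⟨O, hO, hwO, hOU⟩ := mem_nhdsWithin.1 ((hc a w hw).eventually_lt_const hlt)
        obtain ⟨x, hxO, hxD⟩ := mem_closure_iff.1 (hDd' hw) O hO hwO
        exact absurd (h1 x hxD) (not_le.2 (hOU ⟨hxO, hDU' hxD⟩))
    rw [key]
    refine MeasurableSet.iInter fun n => MeasurableSet.biUnion hD fun v hv =>
      MeasurableSet.biInter hD' fun w hw => ?_
    exact measurableSet_le (hm v (hDU hv).1) ((hm w (hDU' hw)).add_const _)

theorem exists_measurable_argmin {d : ℕ} {U : Set (EuclideanSpace ℝ (Fin d))}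
    (hU : IsCompact U) (hne : U.Nonempty) {φ : α → EuclideanSpace ℝ (Fin d) → ℝ}
    (hm : ∀ v ∈ U, Measurable fun a => φ a v) (hc : ∀ a, ContinuousOn (φ a) U) :
    ∃ s : α → EuclideanSpace ℝ (Fin d), Measurable s ∧
      ∀ a, s a ∈ U ∧ ∀ v ∈ U, φ a (s a) ≤ φ a v :=
  (measurableCompactValued_argmin hU hne hm hc).exists_measurable_selection

end Selection

/-! ### Gronwall, Carathéodory existence and a Taylor bound -/

section Volterra

variable {E : Type*} [NormedAddCommGroup E] [NormedSpace ℝ E]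

/-- Extended by zero off `S`, the function `F` is measurable on the whole space, and the extension
is not seen along `φ`. -/
theorem ContinuousOn.aestronglyMeasurable_comp {α X Y : Type*} [MeasurableSpace α]
    [TopologicalSpace X] [MeasurableSpace X] [BorelSpace X] [SecondCountableTopology X]
    [TopologicalSpace Y] [TopologicalSpace.PseudoMetrizableSpace Y] [Zero Y]
    {F : X → Y} {S : Set X} (hF : ContinuousOn F S) (hS : MeasurableSet S) {μ : Measure α}
    {φ : α → X} (hφ : AEMeasurable φ μ) (hφS : ∀ᵐ a ∂μ, φ a ∈ S) :
    AEStronglyMeasurable (fun a => F (φ a)) μ := by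
  have h1 : StronglyMeasurable (S.indicator F) := by
    have : StronglyMeasurable (S.domRestrict F) :=
      (continuousOn_iff_continuous_domRestrict.1 hF).stronglyMeasurable
    refine stronglyMeasurable_of_restrict_of_restrict_compl hS ?_ ?_
    · convert this using 1
      ext a
      simp
    · convert stronglyMeasurable_const (β := Y) (b := 0) using 1
      ext a
      exact indicator_of_notMem a.2 F
  refine (h1.aestronglyMeasurable.comp_aemeasurable hφ).congr ?_
  filter_upwards [hφS] with a ha
  simp [Function.comp, indicator_of_mem ha]

theorem integral_mul_exp_mul {c : ℝ} (t : ℝ) :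
    ∫ s in (0 : ℝ)..t, c * Real.exp (c * s) = Real.exp (c * t) - 1 := by
  have : ∀ s ∈ uIcc 0 t, HasDerivAt (fun s => Real.exp (c * s)) (c * Real.exp (c * s)) s := by
    intro s _
    have := ((hasDerivAt_id s).const_mul c).exp
    simpa [mul_comm] using this
  rw [intervalIntegral.integral_eq_sub_of_hasDerivAt this
    (by apply Continuous.intervalIntegrable; fun_prop)]
  simp

/-- A form of the integral Gronwall inequality. -/
theorem le_mul_exp_of_le_integral {T L K : ℝ} (hL : 0 < L) (hK : 0 ≤ K) {d : ℝ → ℝ}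
    (hd : ContinuousOn d (Icc 0 T)) (hd0 : ∀ t ∈ Icc 0 T, 0 ≤ d t)
    (h : ∀ t ∈ Icc 0 T, d t ≤ K + L * ∫ s in (0 : ℝ)..t, d s) :
    ∀ t ∈ Icc 0 T, d t ≤ 2 * K * Real.exp (2 * L * T) := by
  intro t₀ ht₀
  have hexp : Continuous fun t : ℝ => Real.exp (-(2 * L * t)) := by fun_prop
  -- At a maximum point of the weighted function, the exponent `2 * L` makes the integral term at
  -- most half of the left side, so it can be absorbed.
  obtain ⟨τ, hτ, hmax⟩ := isCompact_Icc.exists_isMaxOn ⟨t₀, ht₀⟩ (hexp.continuousOn.mul hd)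
  set M := Real.exp (-(2 * L * τ)) * d τ with hM
  have hbound : ∀ s ∈ Icc 0 T, d s ≤ M * Real.exp (2 * L * s) := by
    intro s hs
    have h1 : Real.exp (-(2 * L * s)) * d s ≤ M := hmax hs
    have h2 : d s = Real.exp (-(2 * L * s)) * d s * Real.exp (2 * L * s) := by
      rw [mul_right_comm, ← Real.exp_add]; simp
    rw [h2]
    gcongr
  have hint : ∫ s in (0 : ℝ)..τ, d s ≤ ∫ s in (0 : ℝ)..τ, M * Real.exp (2 * L * s) := by
    refine intervalIntegral.integral_mono_on hτ.1 ?_ ?_ fun s hs => hbound s ⟨hs.1, hs.2.trans hτ.2⟩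
    · apply ContinuousOn.intervalIntegrable_of_Icc hτ.1
      exact hd.mono (Icc_subset_Icc_right hτ.2)
    · apply Continuous.intervalIntegrable; fun_prop
  have hval : L * ∫ s in (0 : ℝ)..τ, M * Real.exp (2 * L * s) =
      M / 2 * (Real.exp (2 * L * τ) - 1) := by
    rw [← integral_mul_exp_mul (c := 2 * L) τ, ← intervalIntegral.integral_const_mul,
      ← intervalIntegral.integral_const_mul]
    congr 1; ext s; ring
  have hM0 : 0 ≤ M := mul_nonneg (Real.exp_pos _).le (hd0 τ hτ)
  have hdτ : d τ = M * Real.exp (2 * L * τ) := by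
    rw [hM, mul_right_comm, ← Real.exp_add]; simp
  have h3 := h τ hτ
  have h4 := mul_le_mul_of_nonneg_left hint hL.le
  have h5 : M ≤ 2 * K := by
    have h6 : 1 ≤ Real.exp (2 * L * τ) := Real.one_le_exp (by have := hτ.1; positivity)
    nlinarith
  calc d t₀ ≤ M * Real.exp (2 * L * t₀) := hbound t₀ ht₀
    _ ≤ 2 * K * Real.exp (2 * L * T) := by
      have := ht₀.2
      gcongr

/-- Existence of Carathéodory solutions for a vector field that is Lipschitz in the state. -/
theorem exists_integral_equation_solution [CompleteSpace E] {T L : ℝ} (hT : 0 ≤ T) (hL : 0 < L)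
    {g : ℝ → E → E}
    (hm : ∀ y : ℝ → E, Continuous y →
      AEStronglyMeasurable (fun t => g t (y t)) (volume.restrict (Icc 0 T)))
    (hlip : ∀ᵐ t ∂volume.restrict (Icc 0 T), ∀ x y, ‖g t x - g t y‖ ≤ L * ‖x - y‖)
    (h0 : Integrable (fun t => g t 0) (volume.restrict (Icc 0 T))) (a : E) :
    ∃ y : ℝ → E, Continuous y ∧ Integrable (fun t => g t (y t)) (volume.restrict (Icc 0 T)) ∧
      ∀ t ∈ Icc 0 T, y t = a + ∫ s in (0 : ℝ)..t, g s (y s) := by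
  have hint : ∀ y : ℝ → E, Continuous y →
      Integrable (fun t => g t (y t)) (volume.restrict (Icc 0 T)) := by
    intro y hy
    have hy' : IntegrableOn (fun t => L * ‖y t‖) (Icc 0 T) :=
      (by fun_prop : Continuous fun t => L * ‖y t‖).continuousOn.integrableOn_Icc
    refine (h0.norm.add hy').mono' (hm y hy) ?_
    filter_upwards [hlip] with t ht
    have := ht (y t) 0
    rw [sub_zero] at this
    calc ‖g t (y t)‖ = ‖g t 0 + (g t (y t) - g t 0)‖ := by simp
      _ ≤ ‖g t 0‖ + ‖g t (y t) - g t 0‖ := norm_add_le _ _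
      _ ≤ _ := by simpa using this
  have hii : ∀ y : ℝ → E, Continuous y → ∀ t ∈ Icc 0 T,
      IntervalIntegrable (fun t => g t (y t)) volume 0 t := by
    intro y hy t ht
    rw [intervalIntegrable_iff_integrableOn_Icc_of_le ht.1]
    exact IntegrableOn.mono_set (hint y hy) (Icc_subset_Icc_right ht.2)
  -- The unknown is `z t = exp (-2Lt) • y t`. The sup norm of `z` is a weighted norm of `y` in which
  -- the Picard map contracts by `1 / 2` on all of `[0, T]`, whatever its length.
  let ext (z : C(Icc (0 : ℝ) T, E)) (t : ℝ) : E :=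
    Real.exp (2 * L * t) • IccExtend hT z t
  have hext : ∀ z, Continuous (ext z) := by
    intro z
    have : Continuous (IccExtend hT z) := z.continuous.Icc_extend'
    fun_prop
  have hprim : ∀ z, Continuous fun t : Icc (0 : ℝ) T =>
      Real.exp (-(2 * L * t)) • (a + ∫ s in (0 : ℝ)..t, g s (ext z s)) := by
    intro z
    have h1 : ContinuousOn (fun t => ∫ s in (0 : ℝ)..t, g s (ext z s)) (Icc 0 T) := by
      have := intervalIntegral.continuousOn_primitive_interval (f := fun s => g s (ext z s))
        (a := 0) (b := T) (μ := volume) (by rw [uIcc_of_le hT]; exact hint _ (hext z))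
      rwa [uIcc_of_le hT] at this
    have h2 := continuousOn_iff_continuous_domRestrict.1 h1
    have h3 : Continuous fun t : Icc (0 : ℝ) T => Real.exp (-(2 * L * t)) := by fun_prop
    exact h3.smul (continuous_const.add h2)
  let F (z : C(Icc (0 : ℝ) T, E)) : C(Icc (0 : ℝ) T, E) := ⟨_, hprim z⟩
  have hF : ContractingWith (1 / 2) F := by
    refine ⟨by norm_num [← NNReal.coe_lt_coe], LipschitzWith.of_dist_le_mul fun z w => ?_⟩
    rw [ContinuousMap.dist_le (by positivity)]
    intro t
    have ht := t.2
    have h1 : ‖∫ s in (0 : ℝ)..t, (g s (ext z s) - g s (ext w s))‖ ≤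
        ∫ s in (0 : ℝ)..t, dist z w / 2 * (2 * L * Real.exp (2 * L * s)) := by
      refine intervalIntegral.norm_integral_le_of_norm_le ht.1 ?_ ?_
      · rw [ae_restrict_iff' measurableSet_Icc] at hlip
        filter_upwards [hlip] with s hs hst
        refine (hs ⟨hst.1.le, hst.2.trans ht.2⟩ _ _).trans ?_
        simp only [ext]
        rw [← smul_sub, norm_smul, Real.norm_eq_abs, Real.abs_exp, ← dist_eq_norm]
        have : dist (IccExtend hT z s) (IccExtend hT w s) ≤ dist z w :=
          ContinuousMap.dist_apply_le_dist _
        calc _ ≤ L * (Real.exp (2 * L * s) * dist z w) := by gcongr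
          _ = _ := by ring
      · apply Continuous.intervalIntegrable; fun_prop
    rw [intervalIntegral.integral_const_mul, integral_mul_exp_mul] at h1
    have h2 : F z t - F w t = Real.exp (-(2 * L * t)) •
        ∫ s in (0 : ℝ)..t, (g s (ext z s) - g s (ext w s)) := by
      rw [intervalIntegral.integral_sub (hii _ (hext z) t ht) (hii _ (hext w) t ht)]
      simp only [F, ContinuousMap.coe_mk]
      rw [← smul_sub]
      congr 1
      abel
    rw [dist_eq_norm, h2, norm_smul, Real.norm_eq_abs, Real.abs_exp]
    calc _ ≤ Real.exp (-(2 * L * t)) * (dist z w / 2 * (Real.exp (2 * L * t) - 1)) := by gcongr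
      _ = dist z w / 2 * (1 - Real.exp (-(2 * L * t))) := by
        have : Real.exp (-(2 * L * t)) * Real.exp (2 * L * t) = 1 := by
          rw [← Real.exp_add]; simp
        linear_combination (dist z w / 2) * this
      _ ≤ dist z w / 2 * 1 := by
        gcongr
        linarith [Real.exp_pos (-(2 * L * (t : ℝ)))]
      _ = _ := by push_cast; ring
  have : Nonempty C(Icc (0 : ℝ) T, E) := ⟨0⟩
  have hfix : F (hF.fixedPoint F) = hF.fixedPoint F := hF.fixedPoint_isFixedPt
  set z := hF.fixedPoint F
  refine ⟨ext z, hext z, hint _ (hext z), fun t ht => ?_⟩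
  have h1 : z ⟨t, ht⟩ = Real.exp (-(2 * L * t)) • (a + ∫ s in (0 : ℝ)..t, g s (ext z s)) := by
    conv_lhs => rw [← hfix]
    rfl
  have h2 : ext z t = Real.exp (2 * L * t) • z ⟨t, ht⟩ := by
    simp only [ext]
    rw [IccExtend_of_mem hT z ht]
  rw [h2, h1, smul_smul, ← Real.exp_add]
  simp

/-- The mean value inequality on the segment from `x` to `y`, where the derivative differs from its
value at `x` by at most `L * ‖y - x‖`. The sharp factor `1 / 2` is not needed. -/
theorem norm_image_sub_sub_le_of_fderiv_lipschitz {F : Type*} [NormedAddCommGroup F]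
    [NormedSpace ℝ F] {f : E → F} {s : Set E} (hs : Convex ℝ s) {L : ℝ} (hL : 0 ≤ L)
    (hf : ∀ x ∈ s, DifferentiableAt ℝ f x)
    (hlip : ∀ x ∈ s, ∀ y ∈ s, ‖fderiv ℝ f x - fderiv ℝ f y‖ ≤ L * ‖x - y‖)
    {x y : E} (hx : x ∈ s) (hy : y ∈ s) :
    ‖f y - f x - fderiv ℝ f x (y - x)‖ ≤ L * ‖y - x‖ ^ 2 := by
  have hsub : segment ℝ x y ⊆ s := hs.segment_subset hx hy
  have h := (convex_segment x y).norm_image_sub_le_of_norm_fderiv_le' (𝕜 := ℝ) (f := f)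
    (φ := fderiv ℝ f x) (C := L * ‖y - x‖) (fun z hz => hf z (hsub hz)) (fun z hz => by
      refine (hlip z (hsub hz) x hx).trans ?_
      gcongr
      have := norm_sub_le_of_mem_segment hz
      simpa [norm_sub_rev] using this)
    (left_mem_segment ℝ x y) (right_mem_segment ℝ x y)
  calc _ ≤ _ := h
    _ = _ := by ring

end Volterra

/-- Integration by parts for a forward and a backward primitive. -/
theorem integral_inner_primitive {E : Type*} [NormedAddCommGroup E] [InnerProductSpace ℝ E]
    [CompleteSpace E] {T : ℝ} (hT : 0 ≤ T) {g h : ℝ → E}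
    (hg : IntegrableOn g (Icc 0 T)) (hh : IntegrableOn h (Icc 0 T)) :
    ∫ t in (0 : ℝ)..T, inner ℝ (∫ s in t..T, h s) (g t) =
      ∫ s in (0 : ℝ)..T, inner ℝ (h s) (∫ t in (0 : ℝ)..s, g t) := by
  have hg' : Integrable g (volume.restrict (Ioc 0 T)) := hg.mono_set Ioc_subset_Icc_self
  have hh' : Integrable h (volume.restrict (Ioc 0 T)) := hh.mono_set Ioc_subset_Icc_self
  set μ := volume.restrict (Ioc 0 T)
  -- Both sides are iterated integrals over the triangle `t < s`, so the identity is Fubini.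
  let k : ℝ → ℝ → ℝ := fun t s => {z : ℝ × ℝ | z.1 < z.2}.indicator
    (fun z => inner ℝ (h z.2) (g z.1)) (t, s)
  have hk : Integrable (Function.uncurry k) (μ.prod μ) := by
    have h1 : Integrable (fun z : ℝ × ℝ => inner ℝ (h z.2) (g z.1)) (μ.prod μ) := by
      refine ((hg'.norm).mul_prod (hh'.norm)).mono' ?_ ?_
      · exact (hh'.aestronglyMeasurable.comp_snd).inner hg'.aestronglyMeasurable.comp_fst
      · exact Filter.Eventually.of_forall fun z => by
          rw [mul_comm]; exact norm_inner_le_norm _ _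
    exact h1.indicator (measurableSet_lt measurable_fst measurable_snd)
  have hswap := integral_integral_swap hk
  rw [intervalIntegral.integral_of_le hT, intervalIntegral.integral_of_le hT]
  convert hswap using 1
  · refine setIntegral_congr_fun measurableSet_Ioc fun t ht => ?_
    have : ∀ s, k t s = (Ioi t).indicator (fun s => inner ℝ (h s) (g t)) s := fun s => by
      simp [k, indicator]
    simp only [this]
    rw [integral_indicator measurableSet_Ioi, Measure.restrict_restrict measurableSet_Ioi,
      intervalIntegral.integral_of_le ht.2, real_inner_comm]
    have hset : Ioi t ∩ Ioc 0 T = Ioc t T := by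
      ext s; simp only [mem_inter_iff, mem_Ioi, mem_Ioc]
      exact ⟨fun h => ⟨h.1, h.2.2⟩, fun h => ⟨h.1, ht.1.trans h.1, h.2⟩⟩
    rw [hset, ← integral_inner (hh'.mono_measure
      (Measure.restrict_mono (Ioc_subset_Ioc_left ht.1.le) le_rfl))]
    simp only [real_inner_comm]
  · refine setIntegral_congr_fun measurableSet_Ioc fun s hs => ?_
    have : ∀ t, k t s = (Iio s).indicator (fun t => inner ℝ (h s) (g t)) t := fun t => by
      simp [k, indicator]
    simp only [this]
    rw [integral_indicator measurableSet_Iio, Measure.restrict_restrict measurableSet_Iio,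
      intervalIntegral.integral_of_le hs.1.le]
    have hset : Iio s ∩ Ioc 0 T = Ioo 0 s := by
      ext t; simp only [mem_inter_iff, mem_Iio, mem_Ioc, mem_Ioo]
      exact ⟨fun h => ⟨h.2.1, h.1⟩, fun h => ⟨h.2, h.1, h.2.le.trans hs.2⟩⟩
    rw [hset, ← integral_Ioc_eq_integral_Ioo, ← integral_inner (hg'.mono_measure
      (Measure.restrict_mono (Ioc_subset_Ioc_right hs.2) le_rfl))]

/-! ### Measurability and integrability along trajectories -/

namespace ControlProblem
variable {n m : ℕ} {P : ControlProblem n m}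

local notation "X" => EuclideanSpace ℝ (Fin n)
local notation "V" => EuclideanSpace ℝ (Fin m)

instance isFiniteMeasure_timeMeasure : IsFiniteMeasure P.timeMeasure := by
  unfold timeMeasure; infer_instance

theorem timeMeasure_real_univ (hT : 0 < P.T) : P.timeMeasure.real univ = P.T := by
  simp [timeMeasure, measureReal_def, hT.le]

theorem ae_mem_Icc : ∀ᵐ t ∂P.timeMeasure, t ∈ Icc 0 P.T :=
  ae_restrict_mem measurableSet_Icc

theorem intervalIntegral_eq_integral_timeMeasure {Y : Type*} [NormedAddCommGroup Y]
    [NormedSpace ℝ Y] (hT : 0 < P.T) (g : ℝ → Y) :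
    ∫ t in (0 : ℝ)..P.T, g t = ∫ t, g t ∂P.timeMeasure := by
  rw [timeMeasure, intervalIntegral.integral_of_le hT.le, integral_Icc_eq_integral_Ioc]

theorem intervalIntegrable_of_integrable {Y : Type*} [NormedAddCommGroup Y] {g : ℝ → Y}
    (hg : Integrable g P.timeMeasure) {a b : ℝ} (ha : a ∈ Icc 0 P.T) (hb : b ∈ Icc 0 P.T) :
    IntervalIntegrable g volume a b := by
  rw [intervalIntegrable_iff']
  exact IntegrableOn.mono_set hg (uIcc_subset_Icc ha hb)

theorem continuousOn_primitive {g : ℝ → X} (hT : 0 < P.T) (hg : Integrable g P.timeMeasure) :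
    ContinuousOn (fun t => ∫ s in (0 : ℝ)..t, g s) (Icc 0 P.T) := by
  have := intervalIntegral.continuousOn_primitive_interval (f := g) (a := 0) (b := P.T)
    (μ := volume) (by rw [uIcc_of_le hT.le]; exact hg)
  rwa [uIcc_of_le hT.le] at this

theorem SolvesFrom.continuousOn {y g : ℝ → X} {a : X} (hT : 0 < P.T) (h : P.SolvesFrom y g a) :
    ContinuousOn y (Icc 0 P.T) :=
  (continuousOn_const.add (continuousOn_primitive hT h.1)).congr h.2

theorem aestronglyMeasurable_of_continuousOn {Y : Type*} [NormedAddCommGroup Y] {y : ℝ → Y}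
    (h : ContinuousOn y (Icc 0 P.T)) : AEStronglyMeasurable y P.timeMeasure :=
  h.aestronglyMeasurable_of_isCompact isCompact_Icc measurableSet_Icc

theorem memLp_two_of_continuousOn {y : ℝ → X} (h : ContinuousOn y (Icc 0 P.T)) :
    MemLp y 2 P.timeMeasure := by
  obtain ⟨C, hC⟩ := isCompact_Icc.exists_bound_of_continuousOn h
  refine MemLp.of_bound (aestronglyMeasurable_of_continuousOn h) C ?_
  filter_upwards [ae_mem_Icc] with t ht using hC t ht

theorem integrable_inner_of_continuousOn {p g : ℝ → X} (hp : ContinuousOn p (Icc 0 P.T))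
    (hg : Integrable g P.timeMeasure) :
    Integrable (fun t => inner ℝ (p t) (g t)) P.timeMeasure := by
  obtain ⟨C, hC⟩ := isCompact_Icc.exists_bound_of_continuousOn hp
  refine (hg.norm.const_mul C).mono'
    ((aestronglyMeasurable_of_continuousOn hp).inner hg.aestronglyMeasurable) ?_
  filter_upwards [ae_mem_Icc] with t ht
  exact (norm_inner_le_norm _ _).trans (by gcongr; exact hC t ht)

theorem integrable_clm_apply {Y Z : Type*} [NormedAddCommGroup Y] [NormedSpace ℝ Y]
    [NormedAddCommGroup Z] [NormedSpace ℝ Z] {A : ℝ → Y →L[ℝ] Z}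
    {C : ℝ} (hA : AEStronglyMeasurable A P.timeMeasure)
    (hC : ∀ᵐ t ∂P.timeMeasure, ‖A t‖ ≤ C) {y : ℝ → Y} (hy : Integrable y P.timeMeasure) :
    Integrable (fun t => A t (y t)) P.timeMeasure := by
  refine (hy.norm.const_mul C).mono' ?_ ?_
  · exact (ContinuousLinearMap.id ℝ (Y →L[ℝ] Z)).aestronglyMeasurable_comp₂ hA
      hy.aestronglyMeasurable
  · filter_upwards [hC] with t ht
    exact ((A t).le_opNorm _).trans (by gcongr)

/-- Lipschitz continuity of a function of `(t, x, u)` on `[0, T] × ℝⁿ × U`. -/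
def LipOn (P : ControlProblem n m) {Y : Type*} [NormedAddCommGroup Y] (L : ℝ)
    (G : ℝ → X → V → Y) : Prop :=
  ∀ t₁ ∈ Icc 0 P.T, ∀ t₂ ∈ Icc 0 P.T, ∀ x₁ x₂, ∀ u₁ ∈ P.U, ∀ u₂ ∈ P.U,
    ‖G t₁ x₁ u₁ - G t₂ x₂ u₂‖ ≤ L * (|t₁ - t₂| + ‖x₁ - x₂‖ + ‖u₁ - u₂‖)

theorem LipOn.continuousOn {Y : Type*} [NormedAddCommGroup Y] {L : ℝ}
    {G : ℝ → X → V → Y} (hL : 0 < L) (hG : P.LipOn L G) :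
    ContinuousOn (fun w : ℝ × X × V => G w.1 w.2.1 w.2.2) (Icc 0 P.T ×ˢ univ ×ˢ P.U) := by
  -- The product carries the maximum metric, so the sum of the three distances costs a factor `3`.
  have : LipschitzOnWith (Real.toNNReal (3 * L)) (fun w : ℝ × X × V => G w.1 w.2.1 w.2.2)
      (Icc 0 P.T ×ˢ univ ×ˢ P.U) := by
    refine LipschitzOnWith.of_dist_le_mul fun a ha b hb => ?_
    rw [Real.coe_toNNReal _ (by positivity), dist_eq_norm]
    refine (hG _ ha.1 _ hb.1 _ _ _ ha.2.2 _ hb.2.2).trans ?_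
    have h1 : |a.1 - b.1| ≤ dist a b := le_max_left _ _
    have h2 : ‖a.2.1 - b.2.1‖ ≤ dist a b := by
      rw [← dist_eq_norm]; exact (le_max_left _ _).trans (le_max_right _ _)
    have h3 : ‖a.2.2 - b.2.2‖ ≤ dist a b := by
      rw [← dist_eq_norm]; exact (le_max_right _ _).trans (le_max_right _ _)
    nlinarith
  exact this.continuousOn

theorem LipOn.aestronglyMeasurable {Y : Type*} [NormedAddCommGroup Y] {L : ℝ}
    {G : ℝ → X → V → Y} (hL : 0 < L) (hG : P.LipOn L G) (hU : IsCompact P.U)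
    {x : ℝ → X} (hx : ContinuousOn x (Icc 0 P.T)) {u : ℝ → V} (hu : P.IsInput u) :
    AEStronglyMeasurable (fun t => G t (x t) (u t)) P.timeMeasure := by
  refine (hG.continuousOn hL).aestronglyMeasurable_comp (φ := fun t => (t, x t, u t))
    (measurableSet_Icc.prod (MeasurableSet.univ.prod hU.measurableSet)) ?_ ?_
  · exact aemeasurable_id.prodMk ((aestronglyMeasurable_of_continuousOn hx).aemeasurable.prodMk
      hu.1.aestronglyMeasurable.aemeasurable)
  · filter_upwards [ae_mem_Icc, hu.2] with t ht hut using ⟨ht, mem_univ _, hut⟩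

theorem LipOn.continuousOn_along {Y : Type*} [NormedAddCommGroup Y] {L : ℝ}
    {G : ℝ → X → V → Y} (hL : 0 < L) (hG : P.LipOn L G)
    {x : ℝ → X} (hx : ContinuousOn x (Icc 0 P.T)) :
    ContinuousOn (fun w : ℝ × V => G w.1 (x w.1) w.2) (Icc 0 P.T ×ˢ P.U) := by
  refine (hG.continuousOn hL).comp (f := fun w : ℝ × V => (w.1, x w.1, w.2)) ?_ ?_
  · exact continuousOn_fst.prodMk ((hx.comp continuousOn_fst fun w hw => hw.1).prodMk
      continuousOn_snd)
  · exact fun w hw => ⟨hw.1, mem_univ _, hw.2⟩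

theorem LipOn.exists_bound {Y : Type*} [NormedAddCommGroup Y] {L : ℝ}
    {G : ℝ → X → V → Y} (hL : 0 < L) (hG : P.LipOn L G) (hU : IsCompact P.U)
    {x : ℝ → X} (hx : ContinuousOn x (Icc 0 P.T)) :
    ∃ C, ∀ t ∈ Icc 0 P.T, ∀ v ∈ P.U, ‖G t (x t) v‖ ≤ C := by
  obtain ⟨C, hC⟩ := (isCompact_Icc.prod hU).exists_bound_of_continuousOn
    (hG.continuousOn_along hL hx)
  exact ⟨C, fun t ht v hv => hC (t, v) ⟨ht, hv⟩⟩

theorem LipOn.integrable {Y : Type*} [NormedAddCommGroup Y] {L : ℝ}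
    {G : ℝ → X → V → Y} (hL : 0 < L) (hG : P.LipOn L G) (hU : IsCompact P.U)
    {x : ℝ → X} (hx : ContinuousOn x (Icc 0 P.T)) {u : ℝ → V} (hu : P.IsInput u) :
    Integrable (fun t => G t (x t) (u t)) P.timeMeasure := by
  obtain ⟨C, hC⟩ := hG.exists_bound hL hU hx
  refine Integrable.of_bound (hG.aestronglyMeasurable hL hU hx hu) C ?_
  filter_upwards [ae_mem_Icc, hu.2] with t ht hut using hC t ht _ hut

theorem isInput_of_aestronglyMeasurable (hU : IsCompact P.U) {u : ℝ → V}
    (hm : AEStronglyMeasurable u P.timeMeasure) (hu : ∀ᵐ t ∂P.timeMeasure, u t ∈ P.U) :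
    P.IsInput u := by
  obtain ⟨C, hC⟩ := hU.isBounded.exists_norm_le
  exact ⟨MemLp.of_bound hm C (hu.mono fun t ht => hC _ ht), hu⟩

/-! ### Trajectories, the costate and its duality with variations -/

section Trajectories

variable {L : ℝ}

theorem LipschitzC1With.norm_fx_le (hL : 0 < L) (h : P.LipschitzC1With L) {t : ℝ}
    (ht : t ∈ Icc 0 P.T) (x : X) {u : V} (hu : u ∈ P.U) : ‖P.fx t x u‖ ≤ L := by
  refine norm_fderiv_le_of_lip' ℝ hL.le (Filter.Eventually.of_forall fun y => ?_)
  simpa using h.lip_f t ht t ht y x u hu u hu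

theorem exists_trajectory (hT : 0 < P.T) (hU : IsCompact P.U) (hL : 0 < L)
    (h : P.LipschitzC1With L) {u : ℝ → V} (hu : P.IsInput u) :
    ∃ x, (x, u) ∈ P.feasible := by
  have hf : P.LipOn L P.f := h.lip_f
  obtain ⟨y, hy, hi, hs⟩ := exists_integral_equation_solution (E := X) hT.le hL
    (g := fun t x => P.f t x (u t))
    (fun y hy => hf.aestronglyMeasurable hL hU hy.continuousOn hu)
    (by
      filter_upwards [ae_mem_Icc (P := P), hu.2] with t ht hut x y
      simpa using h.lip_f t ht t ht x y _ hut _ hut)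
    (hf.integrable hL hU (x := fun _ => 0) continuousOn_const hu) P.ξ
  exact ⟨y, memLp_two_of_continuousOn hy.continuousOn, hu, hi, hs⟩

theorem exists_linear_solution (hT : 0 < P.T) (hL : 0 < L) {A : ℝ → X →L[ℝ] X}
    (hA : AEStronglyMeasurable A P.timeMeasure) (hAL : ∀ᵐ t ∂P.timeMeasure, ‖A t‖ ≤ L)
    {b : ℝ → X} (hb : Integrable b P.timeMeasure) (a : X) :
    ∃ y : ℝ → X, Continuous y ∧ P.SolvesFrom y (fun t => A t (y t) + b t) a := by
  obtain ⟨y, hy, hi, hs⟩ := exists_integral_equation_solution (E := X) hT.le hL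
    (g := fun t x => A t x + b t)
    (fun y hy => by
      refine AEStronglyMeasurable.add ?_ hb.aestronglyMeasurable
      exact (ContinuousLinearMap.id ℝ (X →L[ℝ] X)).aestronglyMeasurable_comp₂ hA
        hy.aestronglyMeasurable)
    (by
      filter_upwards [hAL] with t ht x y
      rw [add_sub_add_right_eq_sub, ← map_sub]
      exact ((A t).le_opNorm _).trans (by gcongr))
    (by simp only [map_zero, zero_add]; exact hb) a
  exact ⟨y, hy, hi, hs⟩

theorem feasible.continuousOn (hT : 0 < P.T) {z : (ℝ → X) × (ℝ → V)} (hz : z ∈ P.feasible) :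
    ContinuousOn z.1 (Icc 0 P.T) :=
  hz.2.2.continuousOn hT

theorem LipschitzC1With.aestronglyMeasurable_fx (hT : 0 < P.T) (hU : IsCompact P.U) (hL : 0 < L)
    (h : P.LipschitzC1With L) {z : (ℝ → X) × (ℝ → V)} (hz : z ∈ P.feasible) :
    AEStronglyMeasurable (fun t => P.fx t (z.1 t) (z.2 t)) P.timeMeasure :=
  LipOn.aestronglyMeasurable hL (show P.LipOn L P.fx from h.lip_fx) hU
    (feasible.continuousOn hT hz) hz.2.1

theorem LipschitzC1With.ae_norm_fx_le (hL : 0 < L) (h : P.LipschitzC1With L)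
    {z : (ℝ → X) × (ℝ → V)} (hz : z ∈ P.feasible) :
    ∀ᵐ t ∂P.timeMeasure, ‖P.fx t (z.1 t) (z.2 t)‖ ≤ L := by
  filter_upwards [ae_mem_Icc, hz.2.1.2] with t ht hut using h.norm_fx_le hL ht _ hut

theorem integral_comp_reflect {Y : Type*} [NormedAddCommGroup Y] [NormedSpace ℝ Y]
    (g : ℝ → Y) (T t : ℝ) : ∫ s in (0 : ℝ)..t, g (T - s) = ∫ s in (T - t)..T, g s := by
  rw [intervalIntegral.integral_comp_sub_left]; simp

theorem measurePreserving_reflect :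
    MeasurePreserving (fun t => P.T - t) P.timeMeasure P.timeMeasure := by
  have := (Measure.measurePreserving_sub_left (volume : Measure ℝ) P.T).restrict_preimage
    (measurableSet_Icc (a := 0) (b := P.T))
  simpa [timeMeasure] using this

/-- Under the time reversal `t ↦ T - t`, the costate equation is a homogeneous linear initial value
problem with bounded measurable coefficients. -/
theorem exists_isCostate (hT : 0 < P.T) (hU : IsCompact P.U) (hL : 0 < L)
    (h : P.LipschitzC1With L) {z : (ℝ → X) × (ℝ → V)} (hz : z ∈ P.feasible) :
    ∃ p, P.IsCostate z p := by
  have hρ := measurePreserving_reflect (P := P)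
  have hA : AEStronglyMeasurable (fun t => (P.fx t (z.1 t) (z.2 t)).adjoint) P.timeMeasure :=
    ContinuousLinearMap.adjoint.continuous.comp_aestronglyMeasurable
      (h.aestronglyMeasurable_fx hT hU hL hz)
  have hAL : ∀ᵐ t ∂P.timeMeasure, ‖(P.fx t (z.1 t) (z.2 t)).adjoint‖ ≤ L := by
    filter_upwards [h.ae_norm_fx_le hL hz] with t ht
    rwa [LinearIsometryEquiv.norm_map]
  obtain ⟨q, hq, hi, hs⟩ := exists_linear_solution hT hL (hA.comp_measurePreserving hρ)
    (hρ.quasiMeasurePreserving.ae hAL) (integrable_zero ℝ X _) (gradient P.Ψ (z.1 P.T))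
  refine ⟨fun t => q (P.T - t), ?_, fun t ht => ?_⟩
  · exact integrable_clm_apply hA hAL
      (hq.comp (continuous_const.sub continuous_id)).continuousOn.integrableOn_Icc
  · have := hs (P.T - t) ⟨by linarith [ht.2], by linarith [ht.1]⟩
    simp only [this, Function.comp_apply]
    congr 1
    have h2 := integral_comp_reflect
      (fun s => (P.fx s (z.1 s) (z.2 s)).adjoint (q (P.T - s))) P.T (P.T - t)
    simp only [sub_sub_cancel] at h2
    simpa using h2

theorem IsCostate.continuousOn (hT : 0 < P.T) {z : (ℝ → X) × (ℝ → V)} {p : ℝ → X}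
    (hp : P.IsCostate z p) : ContinuousOn p (Icc 0 P.T) := by
  refine (continuousOn_const.add ?_).congr hp.2
  have := continuousOn_primitive hT hp.1
  refine ((continuousOn_const (c := ∫ s in (0 : ℝ)..P.T,
    (P.fx s (z.1 s) (z.2 s)).adjoint (p s))).sub this).congr fun t ht => ?_
  exact (intervalIntegral.integral_interval_sub_left
    (intervalIntegrable_of_integrable hp.1 ⟨le_rfl, hT.le⟩ ⟨hT.le, le_rfl⟩)
    (intervalIntegrable_of_integrable hp.1 ⟨le_rfl, hT.le⟩ ht)).symm

theorem IsCostate.eqOn (hT : 0 < P.T) (hL : 0 < L)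
    (h : P.LipschitzC1With L) {z : (ℝ → X) × (ℝ → V)} (hz : z ∈ P.feasible) {p q : ℝ → X}
    (hp : P.IsCostate z p) (hq : P.IsCostate z q) : EqOn p q (Icc 0 P.T) := by
  have hρ : ∀ t ∈ Icc 0 P.T, P.T - t ∈ Icc 0 P.T :=
    fun t ht => ⟨by linarith [ht.2], by linarith [ht.1]⟩
  have hc : ContinuousOn (fun t => ‖p t - q t‖) (Icc 0 P.T) :=
    ((hp.continuousOn hT).sub (hq.continuousOn hT)).norm
  have hc' : ContinuousOn (fun t => ‖p (P.T - t) - q (P.T - t)‖) (Icc 0 P.T) :=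
    hc.comp (continuousOn_const.sub continuousOn_id) hρ
  -- Gronwall in reversed time with `K = 0`, since both costates have the same final value.
  have hgr := le_mul_exp_of_le_integral hL le_rfl hc' (fun t _ => norm_nonneg _) (fun t ht => by
    have hT' : P.T ∈ Icc 0 P.T := ⟨hT.le, le_rfl⟩
    rw [hp.2 _ (hρ t ht), hq.2 _ (hρ t ht), add_sub_add_left_eq_sub,
      ← intervalIntegral.integral_sub (intervalIntegrable_of_integrable hp.1 (hρ t ht) hT')
      (intervalIntegrable_of_integrable hq.1 (hρ t ht) hT'),
      integral_comp_reflect (fun s => ‖p s - q s‖), zero_add,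
      ← intervalIntegral.integral_const_mul]
    refine intervalIntegral.norm_integral_le_of_norm_le (hρ t ht).2 ?_ ?_
    · have h1 := h.ae_norm_fx_le hL hz
      rw [timeMeasure, ae_restrict_iff' measurableSet_Icc] at h1
      filter_upwards [h1] with s hs hst
      rw [← map_sub]
      refine (ContinuousLinearMap.le_opNorm _ _).trans ?_
      rw [LinearIsometryEquiv.norm_map]
      gcongr
      exact hs ⟨(hρ t ht).1.trans hst.1.le, hst.2⟩
    · refine ContinuousOn.intervalIntegrable_of_Icc (hρ t ht).2 ?_
      exact (continuousOn_const.mul hc).mono (Icc_subset_Icc_left (hρ t ht).1))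
  intro t ht
  have := hgr _ (hρ t ht)
  simp only [sub_sub_cancel, mul_zero, zero_mul] at this
  exact sub_eq_zero.1 (norm_le_zero_iff.1 this)

theorem isCostate_costate (hT : 0 < P.T) (hU : IsCompact P.U) (hL : 0 < L)
    (h : P.LipschitzC1With L) {z : (ℝ → X) × (ℝ → V)} (hz : z ∈ P.feasible) :
    P.IsCostate z (P.costate z) :=
  Classical.epsilon_spec (exists_isCostate hT hU hL h hz)

/-- The duality between the costate and the variations of the state. -/
theorem IsCostate.inner_gradient_eq (hT : 0 < P.T) (hU : IsCompact P.U) (hL : 0 < L)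
    (h : P.LipschitzC1With L) {z : (ℝ → X) × (ℝ → V)} (hz : z ∈ P.feasible) {p : ℝ → X}
    (hp : P.IsCostate z p) {d g : ℝ → X} (hd : P.SolvesFrom d g 0) :
    inner ℝ (gradient P.Ψ (z.1 P.T)) (d P.T) =
        ∫ t, inner ℝ (p t) (g t - P.fx t (z.1 t) (z.2 t) (d t)) ∂P.timeMeasure ∧
      Integrable (fun t => inner ℝ (p t) (g t - P.fx t (z.1 t) (z.2 t) (d t)))
        P.timeMeasure := by
  have hpc := hp.continuousOn hT
  have hdc := hd.continuousOn hT
  have hfd : Integrable (fun t => P.fx t (z.1 t) (z.2 t) (d t)) P.timeMeasure :=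
    integrable_clm_apply (h.aestronglyMeasurable_fx hT hU hL hz) (h.ae_norm_fx_le hL hz)
      hdc.integrableOn_Icc
  refine ⟨?_, integrable_inner_of_continuousOn hpc (hd.1.sub hfd)⟩
  have hparts := integral_inner_primitive hT.le hd.1 hp.1
  simp only [inner_sub_right]
  rw [integral_sub (integrable_inner_of_continuousOn hpc hd.1)
    (integrable_inner_of_continuousOn hpc hfd)]
  rw [intervalIntegral_eq_integral_timeMeasure hT,
    intervalIntegral_eq_integral_timeMeasure hT] at hparts
  have h1 : ∫ t, inner ℝ (p t) (P.fx t (z.1 t) (z.2 t) (d t)) ∂P.timeMeasure =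
      ∫ t, inner ℝ ((P.fx t (z.1 t) (z.2 t)).adjoint (p t)) (∫ s in (0 : ℝ)..t, g s)
        ∂P.timeMeasure := by
    refine integral_congr_ae ?_
    filter_upwards [ae_mem_Icc] with t ht
    rw [ContinuousLinearMap.adjoint_inner_left, hd.2 t ht, zero_add]
  rw [h1, ← hparts, ← integral_sub (integrable_inner_of_continuousOn hpc hd.1)]
  -- By the costate equation, `p t` minus its tail integral is the constant final gradient, which
  -- comes out of the integral and leaves `∫ g = d T`.
  · have h2 : ∫ t, (inner ℝ (p t) (g t) - inner ℝ (∫ s in t..P.T,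
        (P.fx s (z.1 s) (z.2 s)).adjoint (p s)) (g t)) ∂P.timeMeasure =
        ∫ t, inner ℝ (gradient P.Ψ (z.1 P.T)) (g t) ∂P.timeMeasure := by
      refine integral_congr_ae ?_
      filter_upwards [ae_mem_Icc] with t ht
      rw [← inner_sub_left]
      congr 1
      rw [sub_eq_iff_eq_add]
      exact hp.2 t ht
    rw [h2, integral_inner hd.1, hd.2 P.T ⟨hT.le, le_rfl⟩, zero_add,
      intervalIntegral_eq_integral_timeMeasure hT]
  · refine integrable_inner_of_continuousOn ?_ hd.1
    refine (hpc.sub continuousOn_const).congr (f := fun t => p t - gradient P.Ψ (z.1 P.T))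
      fun t ht => ?_
    rw [eq_sub_iff_add_eq']
    exact (hp.2 t ht).symm

end Trajectories

/-! ### Attainment of both minima -/

section Minima

variable {L : ℝ}

theorem LipschitzC1With.integrable_f (hT : 0 < P.T) (hU : IsCompact P.U) (hL : 0 < L)
    (h : P.LipschitzC1With L) {z : (ℝ → X) × (ℝ → V)} (hz : z ∈ P.feasible) {u : ℝ → V}
    (hu : P.IsInput u) : Integrable (fun t => P.f t (z.1 t) (u t)) P.timeMeasure :=
  LipOn.integrable hL (show P.LipOn L P.f from h.lip_f) hU (feasible.continuousOn hT hz) hu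

theorem LipschitzC1With.integrable_hamiltonian (hT : 0 < P.T) (hU : IsCompact P.U) (hL : 0 < L)
    (h : P.LipschitzC1With L) {z : (ℝ → X) × (ℝ → V)} (hz : z ∈ P.feasible) {p : ℝ → X}
    (hp : P.IsCostate z p) {u : ℝ → V} (hu : P.IsInput u) :
    Integrable (fun t => P.hamiltonian t (z.1 t) (u t) (p t)) P.timeMeasure :=
  integrable_inner_of_continuousOn (hp.continuousOn hT) (h.integrable_f hT hU hL hz hu)

theorem exists_isLeast_hamValues (hT : 0 < P.T) (hU : IsCompact P.U) (hne : P.U.Nonempty)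
    (hL : 0 < L) (h : P.LipschitzC1With L) {z : (ℝ → X) × (ℝ → V)} (hz : z ∈ P.feasible) :
    ∃ v, IsLeast (P.hamValues z) v := by
  have hp := isCostate_costate hT hU hL h hz
  set p := P.costate z
  have hx := feasible.continuousOn hT hz
  have hf : P.LipOn L P.f := h.lip_f
  have hc := hf.continuousOn_along hL hx
  obtain ⟨s, hs, hmin⟩ := exists_measurable_argmin hU hne
    -- The integrand is cut off outside `[0, T]`, where `p`, `x` and `f` are not controlled, because
    -- the selection needs measurability and continuity at every time.
    (φ := fun t v => (Icc 0 P.T).indicator (fun t => inner ℝ (p t) (P.f t (z.1 t) v)) t)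
    (fun v hv => by
      have : ContinuousOn (fun t => inner ℝ (p t) (P.f t (z.1 t) v)) (Icc 0 P.T) :=
        (hp.continuousOn hT).inner (hc.comp (f := fun t => (t, v))
          (continuousOn_id.prodMk continuousOn_const) fun t ht => ⟨ht, hv⟩)
      classical
      rw [← piecewise_eq_indicator]
      exact this.measurable_piecewise continuousOn_const measurableSet_Icc)
    (fun t => by
      by_cases ht : t ∈ Icc 0 P.T
      · simp only [indicator_of_mem ht]
        exact continuousOn_const.inner (hc.comp (f := fun v => (t, v))
          (continuousOn_const.prodMk continuousOn_id) fun v hv => ⟨ht, hv⟩)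
      · simp only [indicator_of_notMem ht]
        exact continuousOn_const)
  have hsin : P.IsInput s := isInput_of_aestronglyMeasurable hU hs.aestronglyMeasurable
    (Filter.Eventually.of_forall fun t => (hmin t).1)
  refine ⟨_, ⟨s, hsin, rfl⟩, ?_⟩
  rintro _ ⟨u, hu, rfl⟩
  rw [intervalIntegral_eq_integral_timeMeasure hT, intervalIntegral_eq_integral_timeMeasure hT]
  have h0 := h.integrable_hamiltonian hT hU hL hz hp hz.2.1
  refine integral_mono_ae ((h.integrable_hamiltonian hT hU hL hz hp hsin).sub h0)
    ((h.integrable_hamiltonian hT hU hL hz hp hu).sub h0) ?_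
  filter_upwards [ae_mem_Icc, hu.2] with t ht hut
  have := (hmin t).2 _ hut
  simp only [indicator_of_mem ht] at this
  exact sub_le_sub_right this _

theorem isLeast_thetaH (hT : 0 < P.T) (hU : IsCompact P.U) (hne : P.U.Nonempty)
    (hL : 0 < L) (h : P.LipschitzC1With L) {z : (ℝ → X) × (ℝ → V)} (hz : z ∈ P.feasible) :
    IsLeast (P.hamValues z) (P.thetaH z) := by
  obtain ⟨v, hv⟩ := exists_isLeast_hamValues hT hU hne hL h hz
  rwa [thetaH, hv.csInf_eq]

theorem zero_mem_hamValues {z : (ℝ → X) × (ℝ → V)} (hz : z ∈ P.feasible) :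
    0 ∈ P.hamValues z :=
  ⟨z.2, hz.2.1, by simp⟩

/-- The adjoint formula for the objective of the linearized problem. -/
theorem IsCostate.inner_gradient_variation (hT : 0 < P.T) (hU : IsCompact P.U) (hL : 0 < L)
    (h : P.LipschitzC1With L) {z : (ℝ → X) × (ℝ → V)} (hz : z ∈ P.feasible) {p : ℝ → X}
    (hp : P.IsCostate z p) {δx : ℝ → X} {δu : ℝ → V}
    (hδ : P.SolvesFrom δx
      (fun t => P.fx t (z.1 t) (z.2 t) (δx t) + P.fu t (z.1 t) (z.2 t) (δu t)) 0) :
    inner ℝ (gradient P.Ψ (z.1 P.T)) (δx P.T) =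
        ∫ t, inner ℝ (p t) (P.fu t (z.1 t) (z.2 t) (δu t)) ∂P.timeMeasure ∧
      Integrable (fun t => inner ℝ (p t) (P.fu t (z.1 t) (z.2 t) (δu t))) P.timeMeasure := by
  simpa using hp.inner_gradient_eq hT hU hL h hz hδ

theorem exists_variation (hT : 0 < P.T) (hU : IsCompact P.U)
    (hL : 0 < L) (h : P.LipschitzC1With L) {z : (ℝ → X) × (ℝ → V)} (hz : z ∈ P.feasible)
    {δu : ℝ → V} (hδu : Integrable δu P.timeMeasure) :
    ∃ δx, MemLp δx 2 P.timeMeasure ∧ P.SolvesFrom δx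
      (fun t => P.fx t (z.1 t) (z.2 t) (δx t) + P.fu t (z.1 t) (z.2 t) (δu t)) 0 := by
  have hx := feasible.continuousOn hT hz
  have hfu : P.LipOn L P.fu := h.lip_fu
  obtain ⟨C, hC⟩ := hfu.exists_bound hL hU hx
  have hb : Integrable (fun t => P.fu t (z.1 t) (z.2 t) (δu t)) P.timeMeasure :=
    integrable_clm_apply (hfu.aestronglyMeasurable hL hU hx hz.2.1) (C := C) (by
      filter_upwards [ae_mem_Icc, hz.2.1.2] with t ht hut using hC t ht _ hut) hδu
  obtain ⟨δx, hc, hs⟩ := exists_linear_solution hT hL (h.aestronglyMeasurable_fx hT hU hL hz)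
    (h.ae_norm_fx_le hL hz) hb 0
  exact ⟨δx, memLp_two_of_continuousOn hc.continuousOn, hs⟩

/-- By the adjoint formula the objective is the integral of ⟨f_uᵀ p, δu⟩, so it suffices to minimize
a linear functional over `U` at each time. Convexity plays no role. -/
theorem exists_isLeast_linValues (hT : 0 < P.T) (hU : IsCompact P.U) (hne : P.U.Nonempty)
    (hL : 0 < L) (h : P.LipschitzC1With L) {z : (ℝ → X) × (ℝ → V)} (hz : z ∈ P.feasible) :
    ∃ v, IsLeast (P.linValues z) v := by
  have hp := isCostate_costate hT hU hL h hz
  set p := P.costate z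
  have hx := feasible.continuousOn hT hz
  have hfu : P.LipOn L P.fu := h.lip_fu
  have hcm : AEStronglyMeasurable (fun t => (P.fu t (z.1 t) (z.2 t)).adjoint (p t))
      P.timeMeasure :=
    (ContinuousLinearMap.id ℝ (X →L[ℝ] V)).aestronglyMeasurable_comp₂
      (ContinuousLinearMap.adjoint.continuous.comp_aestronglyMeasurable
        (hfu.aestronglyMeasurable hL hU hx hz.2.1))
      (aestronglyMeasurable_of_continuousOn (hp.continuousOn hT))
  -- The selection needs a coefficient measurable everywhere, so f_uᵀ p is replaced by a measurable
  -- representative.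
  obtain ⟨c, hc, hpc⟩ := hcm
  obtain ⟨s, hs, hmin⟩ := exists_measurable_argmin hU hne (φ := fun t v => inner ℝ (c t) v)
    (fun v hv => hc.measurable.inner measurable_const)
    (fun t => (continuous_const.inner continuous_id).continuousOn)
  have hsin : P.IsInput s := isInput_of_aestronglyMeasurable hU hs.aestronglyMeasurable
    (Filter.Eventually.of_forall fun t => (hmin t).1)
  have hδu : MemLp (fun t => s t - z.2 t) 2 P.timeMeasure := hsin.1.sub hz.2.1.1
  obtain ⟨δx, hδx, hδ⟩ := exists_variation hT hU hL h hz (hδu.integrable (by norm_num))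
  refine ⟨_, ⟨δx, _, hδx, hδu, hδ, Filter.Eventually.of_forall fun t => ?_, rfl⟩, ?_⟩
  · simpa using (hmin t).1
  · rintro _ ⟨δx', δu', -, -, hδ', hU', rfl⟩
    obtain ⟨h1, h2⟩ := hp.inner_gradient_variation hT hU hL h hz hδ
    obtain ⟨h1', h2'⟩ := hp.inner_gradient_variation hT hU hL h hz hδ'
    rw [h1, h1']
    refine integral_mono_ae h2 h2' ?_
    filter_upwards [hpc, hU'] with t ht hut
    have := (hmin t).2 _ hut
    rw [inner_add_right] at this
    simp only [← ContinuousLinearMap.adjoint_inner_left, ht, inner_sub_right]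
    linarith

theorem isLeast_thetaL (hT : 0 < P.T) (hU : IsCompact P.U) (hne : P.U.Nonempty)
    (hL : 0 < L) (h : P.LipschitzC1With L) {z : (ℝ → X) × (ℝ → V)} (hz : z ∈ P.feasible) :
    IsLeast (P.linValues z) (P.thetaL z) := by
  obtain ⟨v, hv⟩ := exists_isLeast_linValues hT hU hne hL h hz
  rwa [thetaL, hv.csInf_eq]

theorem zero_mem_linValues {z : (ℝ → X) × (ℝ → V)} (hz : z ∈ P.feasible) :
    0 ∈ P.linValues z := by
  refine ⟨fun _ => 0, fun _ => 0, by simp, by simp, ⟨by simp, by simp⟩, ?_, by simp⟩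
  filter_upwards [hz.2.1.2] with t ht
  simpa using ht

end Minima

/-! ### The increment formula -/

section Increment

variable {L : ℝ}

theorem LipschitzC1With.le_add_gradient (h : P.LipschitzC1With L) (hL : 0 < L) (x y : X) :
    P.Ψ y - P.Ψ x ≤ inner ℝ (gradient P.Ψ x) (y - x) + L * ‖y - x‖ ^ 2 := by
  have := norm_image_sub_sub_le_of_fderiv_lipschitz (f := P.Ψ) convex_univ hL.le
    (fun x _ => h.diff_Ψ x) (fun x _ y _ => by
      have := h.lip_grad x y
      rwa [gradient, gradient, ← map_sub, LinearIsometryEquiv.norm_map] at this)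
    (mem_univ x) (mem_univ y)
  rw [Real.norm_eq_abs] at this
  have h2 := (abs_le.1 this).2
  rw [gradient, InnerProductSpace.toDual_symm_apply]
  linarith

/-- The state depends Lipschitz continuously on the input. -/
theorem LipschitzC1With.norm_state_sub_le (hT : 0 < P.T) (hL : 0 < L)
    (h : P.LipschitzC1With L) {z w : (ℝ → X) × (ℝ → V)} (hz : z ∈ P.feasible)
    (hw : w ∈ P.feasible) : ∀ t ∈ Icc 0 P.T, ‖w.1 t - z.1 t‖ ≤
      2 * (L * ∫ s, ‖w.2 s - z.2 s‖ ∂P.timeMeasure) * Real.exp (2 * L * P.T) := by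
  have hdu : Integrable (fun s => ‖w.2 s - z.2 s‖) P.timeMeasure :=
    ((hw.2.1.1.sub hz.2.1.1).integrable (by norm_num)).norm
  have hdc : ContinuousOn (fun t => ‖w.1 t - z.1 t‖) (Icc 0 P.T) :=
    ((feasible.continuousOn hT hw).sub (feasible.continuousOn hT hz)).norm
  have hdi : Integrable (fun t => ‖w.1 t - z.1 t‖) P.timeMeasure := hdc.integrableOn_Icc
  have h0 : (0 : ℝ) ∈ Icc 0 P.T := ⟨le_rfl, hT.le⟩
  refine le_mul_exp_of_le_integral hL
    (mul_nonneg hL.le (integral_nonneg fun s => norm_nonneg _)) hdc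
    (fun t _ => norm_nonneg _) fun t ht => ?_
  rw [hw.2.2.2 t ht, hz.2.2.2 t ht, add_sub_add_left_eq_sub, ← intervalIntegral.integral_sub
    (intervalIntegrable_of_integrable hw.2.2.1 h0 ht)
    (intervalIntegrable_of_integrable hz.2.2.1 h0 ht)]
  have h1 : ‖∫ s in (0 : ℝ)..t, (P.f s (w.1 s) (w.2 s) - P.f s (z.1 s) (z.2 s))‖ ≤
      ∫ s in (0 : ℝ)..t, (L * ‖w.2 s - z.2 s‖ + L * ‖w.1 s - z.1 s‖) := by
    refine intervalIntegral.norm_integral_le_of_norm_le ht.1 ?_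
      (intervalIntegrable_of_integrable ((hdu.const_mul L).add (hdi.const_mul L)) h0 ht)
    have h1 := hz.2.1.2
    have h2 := hw.2.1.2
    rw [timeMeasure, ae_restrict_iff' measurableSet_Icc] at h1 h2
    filter_upwards [h1, h2] with s hs1 hs2 hst
    have hs : s ∈ Icc 0 P.T := ⟨hst.1.le, hst.2.trans ht.2⟩
    refine (h.lip_f s hs s hs _ _ _ (hs2 hs) _ (hs1 hs)).trans (le_of_eq ?_)
    simp only [sub_self, abs_zero]
    ring
  rw [intervalIntegral.integral_add
    (intervalIntegrable_of_integrable (hdu.const_mul L) h0 ht)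
    (intervalIntegrable_of_integrable (hdi.const_mul L) h0 ht),
    intervalIntegral.integral_const_mul, intervalIntegral.integral_const_mul] at h1
  refine h1.trans ?_
  gcongr
  rw [← intervalIntegral_eq_integral_timeMeasure hT]
  refine intervalIntegral.integral_mono_interval le_rfl ht.1 ht.2
    (Filter.Eventually.of_forall fun s => norm_nonneg _)
    (intervalIntegrable_of_integrable hdu h0 ⟨hT.le, le_rfl⟩)

/-- The increment formula: up to a second order remainder, the variation of the cost is the
integrated variation of the Hamiltonian. -/
theorem LipschitzC1With.exists_cost_sub_le (hT : 0 < P.T) (hU : IsCompact P.U) (hL : 0 < L)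
    (h : P.LipschitzC1With L) {z : (ℝ → X) × (ℝ → V)} (hz : z ∈ P.feasible) {p : ℝ → X}
    (hp : P.IsCostate z p) : ∃ C, 0 ≤ C ∧ ∀ w ∈ P.feasible, P.cost w - P.cost z ≤
      (∫ t, (P.hamiltonian t (z.1 t) (w.2 t) (p t) - P.hamiltonian t (z.1 t) (z.2 t) (p t))
        ∂P.timeMeasure) + C * (∫ t, ‖w.2 t - z.2 t‖ ∂P.timeMeasure) ^ 2 := by
  obtain ⟨M, hM⟩ := isCompact_Icc.exists_bound_of_continuousOn (hp.continuousOn hT)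
  have hM0 : 0 ≤ M := (norm_nonneg _).trans (hM 0 ⟨le_rfl, hT.le⟩)
  set K := 2 * L * Real.exp (2 * L * P.T) with hK
  have hK0 : 0 ≤ K := by positivity
  -- The three terms come from the Taylor remainder of `Ψ`, that of `f` in the state integrated over
  -- `[0, T]`, and the change of `∂f/∂x` with the input.
  refine ⟨L * K ^ 2 + M * (L * K ^ 2 * P.T + L * K), by positivity, fun w hw => ?_⟩
  set I := ∫ t, ‖w.2 t - z.2 t‖ ∂P.timeMeasure with hI
  have hI0 : 0 ≤ I := integral_nonneg fun s => norm_nonneg _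
  have hdu : Integrable (fun s => ‖w.2 s - z.2 s‖) P.timeMeasure :=
    ((hw.2.1.1.sub hz.2.1.1).integrable (by norm_num)).norm
  have hd : ∀ t ∈ Icc 0 P.T, ‖w.1 t - z.1 t‖ ≤ K * I := fun t ht =>
    (h.norm_state_sub_le hT hL hz hw t ht).trans (le_of_eq (by rw [hK]; ring))
  have hsol : P.SolvesFrom (fun t => w.1 t - z.1 t)
      (fun t => P.f t (w.1 t) (w.2 t) - P.f t (z.1 t) (z.2 t)) 0 := by
    refine ⟨hw.2.2.1.sub hz.2.2.1, fun t ht => ?_⟩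
    have h0 : (0 : ℝ) ∈ Icc 0 P.T := ⟨le_rfl, hT.le⟩
    rw [intervalIntegral.integral_sub (intervalIntegrable_of_integrable hw.2.2.1 h0 ht)
      (intervalIntegrable_of_integrable hz.2.2.1 h0 ht)]
    simp only [hw.2.2.2 t ht, hz.2.2.2 t ht]
    abel
  obtain ⟨h1, h2⟩ := hp.inner_gradient_eq hT hU hL h hz hsol
  have hΨ := h.le_add_gradient hL (z.1 P.T) (w.1 P.T)
  rw [h1] at hΨ
  have hdT := hd P.T ⟨hT.le, le_rfl⟩
  have hH : Integrable (fun t => P.hamiltonian t (z.1 t) (w.2 t) (p t) -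
      P.hamiltonian t (z.1 t) (z.2 t) (p t)) P.timeMeasure :=
    (h.integrable_hamiltonian hT hU hL hz hp hw.2.1).sub
    (h.integrable_hamiltonian hT hU hL hz hp hz.2.1)
  have hR : Integrable (fun t => M * (L * (K * I) ^ 2 + L * (K * I) * ‖w.2 t - z.2 t‖))
      P.timeMeasure :=
    ((integrable_const _).add (hdu.const_mul _)).const_mul _
  have hmain : ∫ t, inner ℝ (p t) (P.f t (w.1 t) (w.2 t) - P.f t (z.1 t) (z.2 t) -
      P.fx t (z.1 t) (z.2 t) (w.1 t - z.1 t)) ∂P.timeMeasure ≤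
      ∫ t, ((P.hamiltonian t (z.1 t) (w.2 t) (p t) - P.hamiltonian t (z.1 t) (z.2 t) (p t)) +
        M * (L * (K * I) ^ 2 + L * (K * I) * ‖w.2 t - z.2 t‖)) ∂P.timeMeasure := by
    refine integral_mono_ae h2 (hH.add hR) ?_
    filter_upwards [ae_mem_Icc, hz.2.1.2, hw.2.1.2] with t ht hut hwt
    have e1 : ‖P.f t (w.1 t) (w.2 t) - P.f t (z.1 t) (w.2 t) -
        P.fx t (z.1 t) (w.2 t) (w.1 t - z.1 t)‖ ≤ L * ‖w.1 t - z.1 t‖ ^ 2 := by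
      refine norm_image_sub_sub_le_of_fderiv_lipschitz (f := fun y => P.f t y (w.2 t))
        convex_univ hL.le (fun y _ => h.diff_x t ht y _ hwt) (fun y _ y' _ => ?_)
        (mem_univ _) (mem_univ _)
      simpa [fx] using h.lip_fx t ht t ht y y' _ hwt _ hwt
    have e2 : ‖(P.fx t (z.1 t) (w.2 t) - P.fx t (z.1 t) (z.2 t)) (w.1 t - z.1 t)‖ ≤
        L * ‖w.2 t - z.2 t‖ * ‖w.1 t - z.1 t‖ := by
      refine (ContinuousLinearMap.le_opNorm _ _).trans ?_
      gcongr
      simpa using h.lip_fx t ht t ht (z.1 t) (z.1 t) _ hwt _ hut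
    -- The state is expanded at the new input, so the first bracket is exactly the Hamiltonian
    -- difference. The derivative is then moved back to the old input, at the cost of a product of
    -- state and input changes, again of second order.
    have e3 : P.f t (w.1 t) (w.2 t) - P.f t (z.1 t) (z.2 t) -
        P.fx t (z.1 t) (z.2 t) (w.1 t - z.1 t) =
        (P.f t (z.1 t) (w.2 t) - P.f t (z.1 t) (z.2 t)) +
        ((P.f t (w.1 t) (w.2 t) - P.f t (z.1 t) (w.2 t) -
          P.fx t (z.1 t) (w.2 t) (w.1 t - z.1 t)) +
        (P.fx t (z.1 t) (w.2 t) - P.fx t (z.1 t) (z.2 t)) (w.1 t - z.1 t)) := by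
      rw [_root_.sub_apply]
      abel
    have e4 : ‖(P.f t (w.1 t) (w.2 t) - P.f t (z.1 t) (w.2 t) -
          P.fx t (z.1 t) (w.2 t) (w.1 t - z.1 t)) +
        (P.fx t (z.1 t) (w.2 t) - P.fx t (z.1 t) (z.2 t)) (w.1 t - z.1 t)‖ ≤
        L * (K * I) ^ 2 + L * (K * I) * ‖w.2 t - z.2 t‖ := by
      refine (norm_add_le _ _).trans ?_
      have hdt := hd t ht
      calc _ ≤ L * ‖w.1 t - z.1 t‖ ^ 2 + L * ‖w.2 t - z.2 t‖ * ‖w.1 t - z.1 t‖ :=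
            add_le_add e1 e2
        _ ≤ L * (K * I) ^ 2 + L * ‖w.2 t - z.2 t‖ * (K * I) := by gcongr
        _ = _ := by ring
    rw [e3, inner_add_right, inner_sub_right]
    simp only [hamiltonian]
    gcongr
    refine (real_inner_le_norm _ _).trans ?_
    gcongr
    exact hM t ht
  rw [integral_add hH hR, integral_const_mul, integral_add (integrable_const _)
    (hdu.const_mul _), integral_const, integral_const_mul (L * (K * I)),
    timeMeasure_real_univ hT, smul_eq_mul, ← hI] at hmain
  have hsq : L * ‖w.1 P.T - z.1 P.T‖ ^ 2 ≤ L * (K * I) ^ 2 := by gcongr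
  unfold cost
  calc _ ≤ _ := hΨ
    _ ≤ _ := add_le_add hmain hsq
    _ = _ := by ring

end Increment

/-! ### Nonnegativity at a minimizer -/

section Optimality

variable {L : ℝ}

/-- For large `N` the first order term dominates and fixes the sign. -/
theorem nonneg_of_forall_div_add_div_sq {v C : ℝ}
    (h : ∀ N : ℕ, 0 < N → 0 ≤ v / N + C / (N : ℝ) ^ 2) : 0 ≤ v := by
  by_contra! hv
  obtain ⟨N, hN⟩ := exists_nat_gt (max 0 (C / -v))
  have hN0 : (0 : ℝ) < N := (le_max_left _ _).trans_lt hN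
  have hN1 : C / -v < N := (le_max_right _ _).trans_lt hN
  rw [div_lt_iff₀ (by linarith)] at hN1
  have := h N (by exact_mod_cast hN0)
  have h2 : v / N + C / (N : ℝ) ^ 2 = (v * N + C) / (N : ℝ) ^ 2 := by field_simp
  rw [h2] at this
  have h3 : (v * N + C) / (N : ℝ) ^ 2 < 0 := div_neg_of_neg_of_pos (by linarith) (by positivity)
  linarith

theorem exists_norm_sub_le (hU : IsCompact P.U) :
    ∃ D, 0 ≤ D ∧ ∀ u ∈ P.U, ∀ v ∈ P.U, ‖u - v‖ ≤ D := by
  refine ⟨Metric.diam P.U, Metric.diam_nonneg, fun u hu v hv => ?_⟩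
  rw [← dist_eq_norm]
  exact Metric.dist_le_diam_of_mem hU.isBounded hu hv

/-- Some interval of a uniform partition carries at most its share of an integral. -/
theorem exists_setIntegral_Ioc_le {T : ℝ} (hT : 0 < T) {g : ℝ → ℝ}
    (hg : IntegrableOn g (Icc 0 T)) {N : ℕ} (hN : 0 < N) :
    ∃ a b, 0 ≤ a ∧ a ≤ b ∧ b ≤ T ∧ b - a = T / N ∧
      ∫ t in Ioc a b, g t ≤ (∫ t in (0 : ℝ)..T, g t) / N := by
  have hN' : (0 : ℝ) < N := by exact_mod_cast hN
  let a : ℕ → ℝ := fun k => k * (T / N)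
  have ha0 : a 0 = 0 := by simp [a]
  have haN : a N = T := by simp only [a]; field_simp
  have hmono : Monotone a := fun i j hij => by
    have : (i : ℝ) ≤ j := by exact_mod_cast hij
    simp only [a]
    gcongr
  have hmem : ∀ k ≤ N, a k ∈ Icc 0 T := fun k hk =>
    ⟨ha0 ▸ hmono (Nat.zero_le k), haN ▸ hmono hk⟩
  have hsum := intervalIntegral.sum_integral_adjacent_intervals (f := g) (μ := volume) (a := a)
    (n := N) (fun k hk => by
      rw [intervalIntegrable_iff']
      exact hg.mono_set (uIcc_subset_Icc (hmem k hk.le) (hmem (k + 1) hk)))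
  rw [ha0, haN] at hsum
  obtain ⟨k, hk, hle⟩ : ∃ k ∈ Finset.range N, ∫ t in (a k)..(a (k + 1)), g t ≤
      (∫ t in (0 : ℝ)..T, g t) / N := by
    refine Finset.exists_le_of_sum_le (Finset.nonempty_range_iff.2 hN.ne') ?_
    rw [hsum, Finset.sum_const, Finset.card_range, nsmul_eq_mul]
    field_simp
    exact le_rfl
  have hk' := Finset.mem_range.1 hk
  refine ⟨a k, a (k + 1), (hmem k hk'.le).1, hmono (Nat.le_succ k), (hmem (k + 1) hk').2, ?_, ?_⟩
  · simp only [a]; push_cast; ring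
  · rwa [intervalIntegral.integral_of_le (hmono (Nat.le_succ k))] at hle

/-- A needle variation: switching between two inputs in time stays in `U` without convexity. -/
theorem nonneg_of_mem_hamValues (hT : 0 < P.T) (hU : IsCompact P.U) (hL : 0 < L)
    (h : P.LipschitzC1With L) {z : (ℝ → X) × (ℝ → V)} (hz : z ∈ P.feasible)
    (hmin : IsMinOn P.cost P.feasible z) {v : ℝ} (hv : v ∈ P.hamValues z) : 0 ≤ v := by
  obtain ⟨u, hu, rfl⟩ := hv
  have hp := isCostate_costate hT hU hL h hz
  set p := P.costate z
  obtain ⟨C, hC0, hC⟩ := h.exists_cost_sub_le hT hU hL hz hp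
  obtain ⟨D, hD0, hD⟩ := exists_norm_sub_le hU
  have hg := (h.integrable_hamiltonian hT hU hL hz hp hu).sub
    (h.integrable_hamiltonian hT hU hL hz hp hz.2.1)
  refine nonneg_of_forall_div_add_div_sq (C := C * (D * P.T) ^ 2) fun N hN => ?_
  -- Pigeonhole over `N` equal intervals replaces a Lebesgue point argument. The interval may vary
  -- with `N`, since the remainder depends only on its length.
  obtain ⟨a, b, ha, hab, hb, hlen, hle⟩ := exists_setIntegral_Ioc_le hT hg hN
  classical
  let w : ℝ → V := (Ioc a b).piecewise u z.2
  have hsub : Ioc a b ⊆ Icc 0 P.T := fun t ht => ⟨ha.trans ht.1.le, ht.2.trans hb⟩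
  have hw : P.IsInput w := by
    refine isInput_of_aestronglyMeasurable hU ?_ ?_
    · exact AEStronglyMeasurable.piecewise measurableSet_Ioc
        hu.1.aestronglyMeasurable.restrict hz.2.1.1.aestronglyMeasurable.restrict
    · filter_upwards [hu.2, hz.2.1.2] with t h1 h2
      by_cases ht : t ∈ Ioc a b
      · simpa [w, piecewise_eq_of_mem _ _ _ ht] using h1
      · simpa [w, piecewise_eq_of_notMem _ _ _ ht] using h2
  obtain ⟨y, hy⟩ := exists_trajectory hT hU hL h hw
  have hrestr : P.timeMeasure.restrict (Ioc a b) = volume.restrict (Ioc a b) := by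
    rw [timeMeasure, Measure.restrict_restrict_of_subset hsub]
  have hI1 : ∫ t, (P.hamiltonian t (z.1 t) (w t) (p t) -
      P.hamiltonian t (z.1 t) (z.2 t) (p t)) ∂P.timeMeasure =
      ∫ t in Ioc a b, (P.hamiltonian t (z.1 t) (u t) (p t) -
        P.hamiltonian t (z.1 t) (z.2 t) (p t)) := by
    rw [← hrestr, ← integral_indicator measurableSet_Ioc]
    congr 1
    ext t
    by_cases ht : t ∈ Ioc a b
    · simp [w, piecewise_eq_of_mem _ _ _ ht, indicator_of_mem ht]
    · simp [w, piecewise_eq_of_notMem _ _ _ ht, indicator_of_notMem ht]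
  have hI2 : ∫ t, ‖w t - z.2 t‖ ∂P.timeMeasure ≤ D * (P.T / N) := by
    have e1 : ∫ t, ‖w t - z.2 t‖ ∂P.timeMeasure ≤
        ∫ t, (Ioc a b).indicator (fun _ => D) t ∂P.timeMeasure := by
      refine integral_mono_ae (((hw.1.sub hz.2.1.1).integrable (by norm_num)).norm)
        ((integrable_const D).indicator measurableSet_Ioc) ?_
      filter_upwards [hu.2, hz.2.1.2] with t h1 h2
      by_cases ht : t ∈ Ioc a b
      · simpa [w, piecewise_eq_of_mem _ _ _ ht, indicator_of_mem ht] using hD _ h1 _ h2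
      · simp [w, piecewise_eq_of_notMem _ _ _ ht, indicator_of_notMem ht]
    refine e1.trans (le_of_eq ?_)
    rw [integral_indicator measurableSet_Ioc, hrestr, setIntegral_const, ← hlen]
    simp [measureReal_def, hab, mul_comm]
  have hcost := hC _ hy
  have hopt : P.cost z ≤ P.cost (y, w) := hmin hy
  simp only [hI1] at hcost
  have hsq : C * (∫ t, ‖w t - z.2 t‖ ∂P.timeMeasure) ^ 2 ≤ C * (D * (P.T / N)) ^ 2 := by
    gcongr
  have heq : C * (D * (P.T / N)) ^ 2 = C * (D * P.T) ^ 2 / (N : ℝ) ^ 2 := by ring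
  simp only [Pi.sub_apply] at hle
  linarith

/-- The inputs u₀ + δu/N are tested. Convexity serves twice: it keeps them in `U`, and it keeps in
`U` the segments along which `f` is expanded in the input. -/
theorem nonneg_of_mem_linValues (hT : 0 < P.T) (hU : IsCompact P.U) (hconv : Convex ℝ P.U)
    (hL : 0 < L) (h : P.LipschitzC1With L) {z : (ℝ → X) × (ℝ → V)} (hz : z ∈ P.feasible)
    (hmin : IsMinOn P.cost P.feasible z) {v : ℝ} (hv : v ∈ P.linValues z) : 0 ≤ v := by
  obtain ⟨δx, δu, -, hδu, hδ, hδU, rfl⟩ := hv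
  have hp := isCostate_costate hT hU hL h hz
  set p := P.costate z
  obtain ⟨C, hC0, hC⟩ := h.exists_cost_sub_le hT hU hL hz hp
  obtain ⟨D, hD0, hD⟩ := exists_norm_sub_le hU
  obtain ⟨M, hM⟩ := isCompact_Icc.exists_bound_of_continuousOn (hp.continuousOn hT)
  have hM0 : 0 ≤ M := (norm_nonneg _).trans (hM 0 ⟨le_rfl, hT.le⟩)
  -- A feasible variation is a difference of two points of `U`, hence essentially bounded. This
  -- makes the second order terms uniform in time.
  have hδD : ∀ᵐ t ∂P.timeMeasure, ‖δu t‖ ≤ D := by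
    filter_upwards [hδU, hz.2.1.2] with t h1 h2
    simpa using hD _ h1 _ h2
  obtain ⟨h1, h2⟩ := hp.inner_gradient_variation hT hU hL h hz hδ
  rw [h1]
  refine nonneg_of_forall_div_add_div_sq (C := M * (L * D ^ 2) * P.T + C * (D * P.T) ^ 2)
    fun N hN => ?_
  have hN' : (1 : ℝ) ≤ N := by exact_mod_cast hN
  let w : ℝ → V := fun t => z.2 t + (1 / (N : ℝ)) • δu t
  have hw : P.IsInput w := by
    refine ⟨hz.2.1.1.add (hδu.const_smul (1 / (N : ℝ))), ?_⟩
    filter_upwards [hδU, hz.2.1.2] with t h1 h2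
    exact hconv.add_smul_mem h2 h1 ⟨by positivity, by rw [div_le_one] <;> linarith⟩
  obtain ⟨y, hy⟩ := exists_trajectory hT hU hL h hw
  have hI1 : ∫ t, (P.hamiltonian t (z.1 t) (w t) (p t) -
      P.hamiltonian t (z.1 t) (z.2 t) (p t)) ∂P.timeMeasure ≤
      ∫ t, (1 / N * inner ℝ (p t) (P.fu t (z.1 t) (z.2 t) (δu t)) +
        M * (L * (1 / N * D) ^ 2)) ∂P.timeMeasure := by
    refine integral_mono_ae ((h.integrable_hamiltonian hT hU hL hz hp hw).sub
      (h.integrable_hamiltonian hT hU hL hz hp hz.2.1))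
      ((h2.const_mul _).add (integrable_const _)) ?_
    filter_upwards [ae_mem_Icc, hw.2, hz.2.1.2, hδD] with t ht h1 h2 h3
    have e1 := norm_image_sub_sub_le_of_fderiv_lipschitz (f := fun v => P.f t (z.1 t) v)
      hconv hL.le (fun v hv => h.diff_u t ht _ v hv) (fun v hv v' hv' => by
        simpa [fu] using h.lip_fu t ht t ht (z.1 t) (z.1 t) v hv v' hv') h2 h1
    have e2 : w t - z.2 t = (1 / (N : ℝ)) • δu t := by simp [w]
    rw [e2, norm_smul, Real.norm_of_nonneg (by positivity), map_smul] at e1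
    have e3 : inner ℝ (p t) (P.f t (z.1 t) (w t) - P.f t (z.1 t) (z.2 t) -
        (1 / (N : ℝ)) • P.fu t (z.1 t) (z.2 t) (δu t)) ≤ M * (L * (1 / N * D) ^ 2) := by
      refine (real_inner_le_norm _ _).trans ?_
      refine mul_le_mul (hM t ht) (e1.trans ?_) (norm_nonneg _) hM0
      gcongr
    rw [inner_sub_right, inner_sub_right, inner_smul_right] at e3
    simp only [hamiltonian]
    linarith
  rw [integral_add (h2.const_mul _) (integrable_const _), integral_const_mul, integral_const,
    timeMeasure_real_univ hT, smul_eq_mul] at hI1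
  have hI2 : ∫ t, ‖w t - z.2 t‖ ∂P.timeMeasure ≤ P.T * (1 / N * D) := by
    have e1 : ∫ t, ‖w t - z.2 t‖ ∂P.timeMeasure ≤ ∫ _, 1 / N * D ∂P.timeMeasure := by
      refine integral_mono_ae (((hw.1.sub hz.2.1.1).integrable (by norm_num)).norm)
        (integrable_const _) ?_
      filter_upwards [hδD] with t h3
      have e2 : w t - z.2 t = (1 / (N : ℝ)) • δu t := by simp [w]
      simp only [e2, norm_smul, Real.norm_of_nonneg (by positivity : 0 ≤ 1 / (N : ℝ))]
      gcongr
    rwa [integral_const, timeMeasure_real_univ hT, smul_eq_mul] at e1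
  have hcost := hC _ hy
  have hopt : P.cost z ≤ P.cost (y, w) := hmin hy
  have hsq : C * (∫ t, ‖w t - z.2 t‖ ∂P.timeMeasure) ^ 2 ≤ C * (P.T * (1 / N * D)) ^ 2 := by
    gcongr
  have hfin := (sub_nonneg.2 hopt).trans (hcost.trans (add_le_add hI1 hsq))
  refine hfin.trans (le_of_eq ?_)
  ring

end Optimality

end ControlProblem

theorem mainTheorem10 (n m : ℕ) (P : ControlProblem n m) (hT : 0 < P.T)
    (hUconn : IsConnected P.U) (hUcomp : IsCompact P.U)
    (hLip : ∃ L : ℝ, 0 < L ∧ P.LipschitzC1With L) :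
    -- the minimum defining `θ_{o,l}` is attained, so that `θ_{o,l}` is well defined
    ((∀ z ∈ P.feasible, IsLeast (P.linValues z) (P.thetaL z)) ∧
      -- `θ_{o,l}` is an optimality function, for convex `U`
      (∀ z ∈ P.feasible, P.thetaL z ≤ 0) ∧
      (Convex ℝ P.U → IsOptimalityFunction P.feasible P.cost P.thetaL)) ∧
    -- the costate exists and is unique, and the minimum defining `θ_{o,h}` is attained
    ((∀ z ∈ P.feasible, P.IsCostate z (P.costate z) ∧
        (∀ p, P.IsCostate z p → Set.EqOn p (P.costate z) (Set.Icc 0 P.T)) ∧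
        IsLeast (P.hamValues z) (P.thetaH z)) ∧
      -- `θ_{o,h}` is an optimality function
      IsOptimalityFunction P.feasible P.cost P.thetaH) := by
  obtain ⟨L, hL, h⟩ := hLip
  have hne := hUconn.nonempty
  have hl := fun z hz => ControlProblem.isLeast_thetaL hT hUcomp hne hL h (z := z) hz
  have hh := fun z hz => ControlProblem.isLeast_thetaH hT hUcomp hne hL h (z := z) hz
  have hl0 : ∀ z ∈ P.feasible, P.thetaL z ≤ 0 := fun z hz =>
    (hl z hz).2 (ControlProblem.zero_mem_linValues hz)
  have hh0 : ∀ z ∈ P.feasible, P.thetaH z ≤ 0 := fun z hz =>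
    (hh z hz).2 (ControlProblem.zero_mem_hamValues hz)
  refine ⟨⟨hl, hl0, fun hconv => ⟨hl0, fun z hz hmin => ?_⟩⟩, fun z hz => ?_,
    hh0, fun z hz hmin => ?_⟩
  · exact le_antisymm (hl0 z hz) (ControlProblem.nonneg_of_mem_linValues hT hUcomp hconv hL h hz
      hmin (hl z hz).1)
  · have hc := ControlProblem.isCostate_costate hT hUcomp hL h hz
    exact ⟨hc, fun p hp => hp.eqOn hT hL h hz hc, hh z hz⟩
  · exact le_antisymm (hh0 z hz) (ControlProblem.nonneg_of_mem_hamValues hT hUcomp hL h hz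
      hmin (hh z hz).1)
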